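/- Let $d\ge 1$ be an integer, $\mathbb{B}^d=\{x\in\mathbb{R}^d:\|x\|\le 1\}$ (Euclidean norm), and for $\mu>-1$ let $\varpi_\mu(x)=(1-\|x\|^2)^\mu$. For a measurable $g:\mathbb{B}^d\to\mathbb{R}$ put $$\|g\|_\mu=\Big(b_\mu\int_{\mathbb{B}^d}|g(x)|^2\varpi_\mu(x)\,dx\Big)^{1/2}\in[0,\infty],\qquad b_\mu=\Big(\int_{\mathbb{B}^d}\varpi_\mu(x)\,dx\Big)^{-1},$$ with value $+\infty$ if the integral diverges, let $L^2(\varpi_\mu,\mathbb{B}^d)$ be the space of those $g$ with $\|g\|_\mu<\infty$, and let $$E_n(g)_\mu=\inf\{\|g-p\|_\mu:\ p \text{ a real polynomial in } d \text{ variables of total degree at most } n\}.$$ For $k\in\mathbb{N}$ let $W_2^k(\varpi_\mu,\mathbb{B}^d)$ be the set of $f\in L^2(\varpi_\mu,\mathbb{B}^d)$ such that for every multi-index $\mathbf m\in\mathbb{N}_0^d$ with $|\mathbf m|=m_1+\dots+m_d\le k$ the weak derivative $\partial^{\mathbf m}f$ on the open unit ball exists and belongs to $L^2(\varpi_{\mu+|\mathbf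 m|},\mathbb{B}^d)$. Let $\partial_i$ denote weak partial derivatives, $\Delta=\sum_{i=1}^d\partial_i^2$, and let $\Delta_0=\sum_{1\le i<j\le d}D_{i,j}^2$ with $D_{i,j}=x_i\partial_j-x_j\partial_i$ be the Laplace–Beltrami operator of the unit sphere, acting in the angular variables. Then for every $d\ge1$, $\mu>-1$ and integer $s\ge 1$ there is a constant $c>0$, depending only on $d$, $\mu$ and $s$, such that for all $f\in W_2^{2s}(\varpi_\mu,\mathbb{B}^d)$ and all integers $n\ge 2s$, $$E_n(f)_\mu\le \frac{c}{n^{2s}}\Big(\|\Delta^s f\|_{\mu+2s}+\|\Delta_0^s f\|_\mu\Big).$$ (The bound is trivially true when $\|\Delta_0^s f\|_\mu=+\infty$.) -/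

import Mathlib

open MeasureTheory
open scoped ENNReal ContDiff

namespace BallApprox

/-! ### The weighted spaces on the unit ball -/

/-- The measure `(1 - ‖x‖²)^μ dx` on the closed unit ball of `ℝ^d`. -/
noncomputable def weightMeasure (d : ℕ) (μ : ℝ) : Measure (EuclideanSpace ℝ (Fin d)) :=
  (volume.restrict (Metric.closedBall 0 1)).withDensity
    fun x => ENNReal.ofReal ((1 - ‖x‖ ^ 2) ^ μ)

/-- The normalized measure `b_μ (1 - ‖x‖²)^μ dx` on the closed unit ball, where `b_μ` is the
reciprocal of the total mass of the weight (which is positive and finite for `μ > -1`). -/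
noncomputable def ballMeasure (d : ℕ) (μ : ℝ) : Measure (EuclideanSpace ℝ (Fin d)) :=
  (weightMeasure d μ Set.univ)⁻¹ • weightMeasure d μ

/-- The norm `‖f‖_μ = (b_μ ∫_{B^d} |f(x)|² (1 - ‖x‖²)^μ dx)^{1/2}`, with value `∞` if the integral
diverges. -/
noncomputable def wnorm {d : ℕ} (μ : ℝ) (f : EuclideanSpace ℝ (Fin d) → ℝ) : ℝ≥0∞ :=
  eLpNorm f 2 (ballMeasure d μ)

/-- The error `E_n(f)_μ` of best approximation of `f` in `‖·‖_μ` by real polynomials in `d`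
variables of total degree at most `n`. -/
noncomputable def bestApprox {d : ℕ} (n : ℕ) (μ : ℝ) (f : EuclideanSpace ℝ (Fin d) → ℝ) : ℝ≥0∞ :=
  ⨅ p : MvPolynomial.restrictTotalDegree (Fin d) ℝ n,
    wnorm μ (fun x => f x - MvPolynomial.eval (fun i => x i) (p : MvPolynomial (Fin d) ℝ))

/-! ### Classical partial derivatives, used on test functions only -/

/-- The classical partial derivative in the `i`-th coordinate direction. -/
noncomputable def partialD {d : ℕ} (i : Fin d) (φ : EuclideanSpace ℝ (Fin d) → ℝ) :
    EuclideanSpace ℝ (Fin d) → ℝ :=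
  fun x => fderiv ℝ φ x (EuclideanSpace.single i 1)

/-- The classical derivative `∂^m = ∂_1^{m_1} ⋯ ∂_d^{m_d}`, for a multi-index `m`. -/
noncomputable def multiD {d : ℕ} (m : Fin d → ℕ) (φ : EuclideanSpace ℝ (Fin d) → ℝ) :
    EuclideanSpace ℝ (Fin d) → ℝ :=
  (List.finRange d).foldr (fun i ψ => (partialD i)^[m i] ψ) φ

/-- Test functions on the open unit ball: smooth, with compact support inside the open ball. -/
structure IsTest {d : ℕ} (φ : EuclideanSpace ℝ (Fin d) → ℝ) : Prop where
  smooth : ContDiff ℝ ∞ φ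
  compact : HasCompactSupport φ
  support : tsupport φ ⊆ Metric.ball 0 1

/-! ### Weak derivatives and Sobolev spaces -/

/-- `g` is the weak derivative `∂^m f` on the open unit ball. -/
structure IsWeakDeriv {d : ℕ} (m : Fin d → ℕ) (f g : EuclideanSpace ℝ (Fin d) → ℝ) : Prop where
  locInt_fun : LocallyIntegrableOn f (Metric.ball 0 1) volume
  locInt_deriv : LocallyIntegrableOn g (Metric.ball 0 1) volume
  integral_eq : ∀ φ : EuclideanSpace ℝ (Fin d) → ℝ, IsTest φ →
    ∫ x, f x * multiD m φ x = (-1) ^ (∑ i, m i) * ∫ x, g x * φ x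

/-- The Sobolev space `W_2^k(ϖ_μ, B^d)`: functions `f ∈ L²(ϖ_μ, B^d)` whose weak derivatives
`∂^m f`, `|m| ≤ k`, exist and belong to `L²(ϖ_{μ+|m|}, B^d)`. -/
def MemW {d : ℕ} (k : ℕ) (μ : ℝ) (f : EuclideanSpace ℝ (Fin d) → ℝ) : Prop :=
  MemLp f 2 (ballMeasure d μ) ∧
    ∀ m : Fin d → ℕ, ∑ i, m i ≤ k →
      ∃ g, IsWeakDeriv m f g ∧ MemLp g 2 (ballMeasure d (μ + ((∑ i, m i : ℕ) : ℝ)))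

/-! ### The differential operators, acting through weak derivatives -/

open Classical in
/-- The weak partial derivative `∂_i f` on the unit ball (a representative of it, which is unique
almost everywhere on the ball; by convention `0` if `f` has no weak partial derivative). -/
noncomputable def weakPartial {d : ℕ} (i : Fin d) (f : EuclideanSpace ℝ (Fin d) → ℝ) :
    EuclideanSpace ℝ (Fin d) → ℝ :=
  if h : ∃ g, IsWeakDeriv (Pi.single i 1) f g then h.choose else 0

/-- The Laplace operator `Δ = ∂_1² + ⋯ + ∂_d²`. -/
noncomputable def laplace {d : ℕ} (f : EuclideanSpace ℝ (Fin d) → ℝ) :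
    EuclideanSpace ℝ (Fin d) → ℝ :=
  fun x => ∑ i, weakPartial i (weakPartial i f) x

/-- The angular derivative `D_{i,j} = x_i ∂_j - x_j ∂_i`. -/
noncomputable def angularD {d : ℕ} (i j : Fin d) (f : EuclideanSpace ℝ (Fin d) → ℝ) :
    EuclideanSpace ℝ (Fin d) → ℝ :=
  fun x => x i * weakPartial j f x - x j * weakPartial i f x

/-- The Laplace-Beltrami operator `Δ_0 = ∑_{i<j} D_{i,j}²` of the unit sphere, acting on functions
on the ball in the angular variables. -/
noncomputable def laplaceBeltrami {d : ℕ} (f : EuclideanSpace ℝ (Fin d) → ℝ) :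
    EuclideanSpace ℝ (Fin d) → ℝ :=
  fun x => ∑ p : Fin d × Fin d with p.1 < p.2, angularD p.1 p.2 (angularD p.1 p.2 f) x

end BallApprox

namespace BallApprox

/-! ### The weight measures -/

section Weight

variable {d : ℕ} {α : ℝ}

/-! The proof diagonalizes `Δ` and `Δ_0` simultaneously on orthogonal polynomials and reads the
estimate off Parseval's identity.

For the weights with exponents `α` and `α + 2`, the adjoint of `Δ` on polynomials is `Δ* q = (1 -
‖x‖²)^(-α) Δ((1 - ‖x‖²)^(α+2) q)`, again a polynomial operator (`adjP`), raising the degree by at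
most two. So `Δ` sends orthogonal polynomials of degree `m` for the exponent `α` to orthogonal
polynomials of degree `m - 2` for `α + 2`, and `Δ*Δ` is symmetric and preserves the degree
filtration. The polar identity `‖x‖² Δ = E² + (d - 2) E + Δ_0`, with `E` the Euler operator, gives
its action on leading parts. On an orthogonal polynomial `p` of degree `m` with `Δ_0 p = -c p`,
symmetry removes the lower order remainder, so `Δ*Δ p = λ p` exactly, with `λ = lapFactor d α m c`
(`IsOrthPoly.adjP_lapP`).

`Δ_0` is symmetric and preserves degrees, so there is an orthonormal basis `e` of such polynomials
(`exists_orthPoly_basis`), complete by Stone–Weierstrass. Iteration shows that the `Δ^s e` with `m ≥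
2s` are orthogonal for the exponent `μ + 2s`, with squared norms `τ = lapPowFactor d s μ m c` when
positive, and that `⟨Δ^s e, Δ^s f⟩ = τ ⟨e, f⟩` (`integral_laplace_pow`). Bessel then bounds sums of
`τ ⟨e, f⟩²` by `‖Δ^s f‖²`; similarly, sums of `c^(2s) ⟨e, f⟩²` are bounded by `‖Δ_0^s f‖²`.

Neither operator suffices alone: `τ` degenerates when `c` is close to `m²`, and `c` may be small.
But if `c < δ m²` then `τ ≥ (δ m²)^(2s)` (`pow_le_lapPowFactor`), and otherwise `c^(2s) ≥ (δ
m²)^(2s)`. Truncating the expansion at degree `n` leaves only `m > n`, which gives the rate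
`n^(-2s)`.

Weak derivatives are tested only against functions supported inside the open ball, so the adjoint
relations come from multiplying weighted polynomials by radial cutoffs and passing to the limit. -/

theorem one_sub_norm_sq_pos {x : EuclideanSpace ℝ (Fin d)} (hx : x ∈ Metric.ball 0 1) :
    0 < 1 - ‖x‖ ^ 2 := by
  have h : ‖x‖ < 1 := by simpa using hx
  nlinarith [norm_nonneg x]

theorem measurable_weight (d : ℕ) (α : ℝ) :
    Measurable fun x : EuclideanSpace ℝ (Fin d) => (1 - ‖x‖ ^ 2) ^ α := by
  fun_prop

/-- The sphere is a null set. On the open ball the weight is positive and the test functions live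
there, so all later work takes place on it. -/
theorem weightMeasure_eq_restrict_ball (d : ℕ) (α : ℝ) :
    weightMeasure d α = (volume.restrict (Metric.ball 0 1)).withDensity
      fun x => ENNReal.ofReal ((1 - ‖x‖ ^ 2) ^ α) := by
  have h : (Metric.closedBall (0 : EuclideanSpace ℝ (Fin d)) 1) =ᵐ[volume] Metric.ball 0 1 := by
    rw [← Metric.ball_union_sphere]
    exact union_ae_eq_left_of_ae_eq_empty
      (ae_eq_empty.2 (Measure.addHaar_sphere_of_ne_zero volume 0 one_ne_zero))
  rw [weightMeasure, Measure.restrict_congr_set h]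

theorem weightMeasure_absolutelyContinuous :
    weightMeasure d α ≪ volume.restrict (Metric.ball 0 1) := by
  rw [weightMeasure_eq_restrict_ball d]
  exact withDensity_absolutelyContinuous _ _

theorem absolutelyContinuous_weightMeasure :
    volume.restrict (Metric.ball 0 1) ≪ weightMeasure d α := by
  rw [weightMeasure_eq_restrict_ball d]
  refine withDensity_absolutelyContinuous' (measurable_weight d α).ennreal_ofReal.aemeasurable ?_
  filter_upwards [ae_restrict_mem Metric.isOpen_ball.measurableSet] with x hx
  simpa using Real.rpow_pos_of_pos (one_sub_norm_sq_pos hx) α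

theorem integral_weightMeasure (g : EuclideanSpace ℝ (Fin d) → ℝ) :
    ∫ x, g x ∂(weightMeasure d α) =
      ∫ x in Metric.ball 0 1, g x * (1 - ‖x‖ ^ 2) ^ α := by
  rw [weightMeasure_eq_restrict_ball d, integral_withDensity_eq_integral_toReal_smul
    (measurable_weight d α).ennreal_ofReal (by simp)]
  refine setIntegral_congr_fun Metric.isOpen_ball.measurableSet fun x hx => ?_
  simp only [smul_eq_mul]
  rw [ENNReal.toReal_ofReal (Real.rpow_pos_of_pos (one_sub_norm_sq_pos hx) α).le, mul_comm]

theorem weight_integrableOn_Ioo (n : ℕ) (hα : -1 < α) :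
    IntegrableOn (fun y : ℝ => y ^ n • (1 - y ^ 2) ^ α) (Set.Ioo 0 1) := by
  have h1 : IntegrableOn (fun y : ℝ => (1 - y) ^ α) (Set.Ioo 0 1) := by
    have h0 := (intervalIntegral.intervalIntegrable_rpow' (a := 0) (b := 1) hα).comp_sub_left 1
    simp only [sub_zero, sub_self] at h0
    exact ((intervalIntegrable_iff_integrableOn_Ioo_of_le zero_le_one).1 h0.symm)
  obtain ⟨C, hC⟩ : ∃ C, ∀ y ∈ Set.Icc (0 : ℝ) 1, ‖y ^ n * (1 + y) ^ α‖ ≤ C := by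
    refine isCompact_Icc.exists_bound_of_continuousOn ?_
    refine (by fun_prop : Continuous fun y : ℝ => y ^ n).continuousOn.mul
      (ContinuousOn.rpow_const (by fun_prop) fun y hy => Or.inl ?_)
    linarith [hy.1]
  refine Integrable.mono' (h1.const_mul C) (Measurable.aestronglyMeasurable (by fun_prop)) ?_
  filter_upwards [ae_restrict_mem measurableSet_Ioo] with y hy
  -- Only the factor `(1 - y)^α` is singular, and it is integrable because `α > -1`; the factor `(1
  -- + y)^α` is bounded on `[0, 1]`.
  have e : (1 - y ^ 2) ^ α = (1 - y) ^ α * (1 + y) ^ α := by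
    rw [← Real.mul_rpow (by linarith [hy.2]) (by linarith [hy.1])]
    ring_nf
  have hp : 0 ≤ (1 - y) ^ α := Real.rpow_nonneg (by linarith [hy.2]) _
  rw [smul_eq_mul, e, mul_left_comm, norm_mul, Real.norm_of_nonneg hp, mul_comm]
  exact mul_le_mul_of_nonneg_right (hC y ⟨hy.1.le, hy.2.le⟩) hp

theorem isFiniteMeasure_weightMeasure (hd : 1 ≤ d) (hα : -1 < α) :
    IsFiniteMeasure (weightMeasure d α) := by
  have : Nonempty (Fin d) := ⟨⟨0, hd⟩⟩
  rw [weightMeasure_eq_restrict_ball d]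
  refine isFiniteMeasure_withDensity_ofReal ?_
  exact ((integrableOn_fun_norm_addHaar (E := EuclideanSpace ℝ (Fin d)) volume
    (f := fun y => (1 - y ^ 2) ^ α)).2 (weight_integrableOn_Ioo _ hα)).2

theorem weightMeasure_univ_ne_zero : weightMeasure d α Set.univ ≠ 0 := by
  intro h
  have h2 := absolutelyContinuous_weightMeasure (α := α) h
  rw [Measure.restrict_apply_univ] at h2
  exact (Metric.measure_ball_pos volume _ one_pos).ne' h2

theorem weightMeasure_mono {α β : ℝ} (h : α ≤ β) :
    weightMeasure d β ≤ weightMeasure d α := by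
  rw [weightMeasure_eq_restrict_ball d, weightMeasure_eq_restrict_ball d]
  refine withDensity_mono ?_
  filter_upwards [ae_restrict_mem Metric.isOpen_ball.measurableSet] with x hx
  exact ENNReal.ofReal_le_ofReal (Real.rpow_le_rpow_of_exponent_ge (one_sub_norm_sq_pos hx)
    (by nlinarith [norm_nonneg x]) h)

theorem memLp_ballMeasure_iff (hd : 1 ≤ d) (hα : -1 < α) {f : EuclideanSpace ℝ (Fin d) → ℝ} :
    MemLp f 2 (ballMeasure d α) ↔ MemLp f 2 (weightMeasure d α) := by
  have := isFiniteMeasure_weightMeasure hd hα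
  have h0 : weightMeasure d α Set.univ ≠ 0 := weightMeasure_univ_ne_zero
  have h1 : weightMeasure d α Set.univ ≠ (∞ : ℝ≥0∞) := measure_ne_top _ _
  constructor
  · intro h
    have := h.smul_measure h1
    rwa [ballMeasure, smul_smul, ENNReal.mul_inv_cancel h0 h1, one_smul] at this
  · intro h
    exact h.smul_measure (by simpa using h0)

theorem wnorm_eq (f : EuclideanSpace ℝ (Fin d) → ℝ) :
    wnorm α f = (weightMeasure d α Set.univ)⁻¹ ^ (2 : ℝ)⁻¹ *
      eLpNorm f 2 (weightMeasure d α) := by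
  rw [wnorm, ballMeasure, eLpNorm_smul_measure_of_ne_top (by simp)]
  simp

/-- Polynomials as functions on Euclidean space. -/
noncomputable def pev (p : MvPolynomial (Fin d) ℝ) (x : EuclideanSpace ℝ (Fin d)) : ℝ :=
  MvPolynomial.eval (fun i => x i) p

@[simp] theorem pev_C (a : ℝ) (x : EuclideanSpace ℝ (Fin d)) :
    pev (MvPolynomial.C a) x = a := by simp [pev]

@[simp] theorem pev_X (i : Fin d) (x : EuclideanSpace ℝ (Fin d)) :
    pev (MvPolynomial.X i) x = x i := by simp [pev]

@[simp] theorem pev_zero (x : EuclideanSpace ℝ (Fin d)) : pev 0 x = 0 := by simp [pev]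

@[simp] theorem pev_one (x : EuclideanSpace ℝ (Fin d)) : pev 1 x = 1 := by simp [pev]

@[simp] theorem pev_add (p q : MvPolynomial (Fin d) ℝ) (x : EuclideanSpace ℝ (Fin d)) :
    pev (p + q) x = pev p x + pev q x := by simp [pev]

@[simp] theorem pev_sub (p q : MvPolynomial (Fin d) ℝ) (x : EuclideanSpace ℝ (Fin d)) :
    pev (p - q) x = pev p x - pev q x := by simp [pev]

@[simp] theorem pev_neg (p : MvPolynomial (Fin d) ℝ) (x : EuclideanSpace ℝ (Fin d)) :
    pev (-p) x = -pev p x := by simp [pev]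

@[simp] theorem pev_mul (p q : MvPolynomial (Fin d) ℝ) (x : EuclideanSpace ℝ (Fin d)) :
    pev (p * q) x = pev p x * pev q x := by simp [pev]

@[simp] theorem pev_smul (a : ℝ) (p : MvPolynomial (Fin d) ℝ) (x : EuclideanSpace ℝ (Fin d)) :
    pev (a • p) x = a * pev p x := by simp [pev]

@[simp] theorem pev_pow (p : MvPolynomial (Fin d) ℝ) (n : ℕ) (x : EuclideanSpace ℝ (Fin d)) :
    pev (p ^ n) x = pev p x ^ n := by simp [pev]

@[simp] theorem pev_sum {ι : Type*} (t : Finset ι) (p : ι → MvPolynomial (Fin d) ℝ)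
    (x : EuclideanSpace ℝ (Fin d)) : pev (∑ i ∈ t, p i) x = ∑ i ∈ t, pev (p i) x := by
  simp [pev, map_sum]

theorem contDiff_pev (p : MvPolynomial (Fin d) ℝ) : ContDiff ℝ ∞ (pev p) := by
  induction p using MvPolynomial.induction_on with
  | C a =>
    rw [show pev (MvPolynomial.C a) = fun _ : EuclideanSpace ℝ (Fin d) => a from
      funext fun x => pev_C a x]
    exact contDiff_const
  | add p q hp hq =>
    rw [show pev (p + q) = fun x => pev p x + pev q x from funext fun x => pev_add p q x]
    exact hp.add hq
  | mul_X p i hp =>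
    rw [show pev (p * MvPolynomial.X i) = fun x => pev p x * x i from
      funext fun x => by simp]
    exact hp.mul (by fun_prop)

theorem continuous_pev (p : MvPolynomial (Fin d) ℝ) : Continuous (pev p) :=
  (contDiff_pev p).continuous

theorem memLp_pev (hd : 1 ≤ d) (hα : -1 < α) (p : MvPolynomial (Fin d) ℝ) {r : ℝ≥0∞} :
    MemLp (pev p) r (weightMeasure d α) := by
  have := isFiniteMeasure_weightMeasure hd hα
  obtain ⟨C, hC⟩ := (isCompact_closedBall (0 : EuclideanSpace ℝ (Fin d)) 1).exists_bound_of_continuousOn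
    (continuous_pev p).continuousOn
  refine MemLp.of_bound (continuous_pev p).aestronglyMeasurable C ?_
  refine weightMeasure_absolutelyContinuous.ae_le ?_
  filter_upwards [ae_restrict_mem Metric.isOpen_ball.measurableSet] with x hx
  exact hC x (Metric.ball_subset_closedBall hx)

theorem eq_zero_of_pev_ae_eq_zero (hd : 1 ≤ d) {p : MvPolynomial (Fin d) ℝ}
    (h : pev p =ᵐ[weightMeasure d α] 0) : p = 0 := by
  have h1 : pev p =ᵐ[volume.restrict (Metric.ball 0 1)] 0 :=
    absolutelyContinuous_weightMeasure.ae_le h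
  have h2 : Set.EqOn (pev p) 0 (Metric.ball 0 1) :=
    Measure.eqOn_open_of_ae_eq h1 Metric.isOpen_ball (continuous_pev p).continuousOn
      continuousOn_const
  have hd0 : (0 : ℝ) < d := by exact_mod_cast hd
  -- The cube with sides `(0, 1/d)` lies in the ball: there `x i ^ 2 < 1/d` for each of the `d`
  -- coordinates. A polynomial vanishing on a product of infinite sets is zero.
  refine MvPolynomial.funext_set (fun _ => Set.Ioo (0 : ℝ) (1 / d))
    (fun _ => Set.Ioo_infinite (by positivity)) fun x hx => ?_
  rw [map_zero]
  refine h2 (x := WithLp.toLp 2 x) ?_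
  rw [mem_ball_zero_iff, EuclideanSpace.norm_eq, Real.sqrt_lt' one_pos, one_pow]
  have : Nonempty (Fin d) := ⟨⟨0, hd⟩⟩
  calc ∑ i, ‖x i‖ ^ 2 < ∑ i : Fin d, (1 / d : ℝ) := by
        refine Finset.sum_lt_sum_of_nonempty Finset.univ_nonempty fun i _ => ?_
        have hi := hx i (Set.mem_univ i)
        have h3 : x i < 1 := hi.2.trans_le (by rw [div_le_one hd0]; exact_mod_cast hd)
        rw [Real.norm_of_nonneg hi.1.le]
        nlinarith [hi.1, hi.2]
    _ = 1 := by simp [hd0.ne']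

end Weight

/-! ### Differential operators on polynomials -/

section Poly

open MvPolynomial

variable {d : ℕ}

/-- The Laplace operator on polynomials. -/
noncomputable def lapP : MvPolynomial (Fin d) ℝ →ₗ[ℝ] MvPolynomial (Fin d) ℝ :=
  ∑ i, (pderiv i).toLinearMap ∘ₗ (pderiv i).toLinearMap

/-- The Euler operator `∑ x_i ∂_i` on polynomials. -/
noncomputable def eulerP : MvPolynomial (Fin d) ℝ →ₗ[ℝ] MvPolynomial (Fin d) ℝ :=
  ∑ i, LinearMap.mulLeft ℝ (X i) ∘ₗ (pderiv i).toLinearMap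

/-- The angular derivative `x_i ∂_j - x_j ∂_i` on polynomials. -/
noncomputable def angP (i j : Fin d) : MvPolynomial (Fin d) ℝ →ₗ[ℝ] MvPolynomial (Fin d) ℝ :=
  LinearMap.mulLeft ℝ (X i) ∘ₗ (pderiv j).toLinearMap -
    LinearMap.mulLeft ℝ (X j) ∘ₗ (pderiv i).toLinearMap

/-- The Laplace-Beltrami operator on polynomials. -/
noncomputable def lbP : MvPolynomial (Fin d) ℝ →ₗ[ℝ] MvPolynomial (Fin d) ℝ :=
  ∑ p : Fin d × Fin d with p.1 < p.2, angP p.1 p.2 ∘ₗ angP p.1 p.2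

/-- The polynomial `∑ x_i ^ 2`. -/
noncomputable def rsq (d : ℕ) : MvPolynomial (Fin d) ℝ := ∑ i, X i ^ 2

/-- The formal adjoint `q ↦ (1 - ‖x‖²)^(-α) Δ ((1 - ‖x‖²)^(α + 2) q)` of the Laplace operator,
with `a = α + 2`. -/
noncomputable def adjP (a : ℝ) : MvPolynomial (Fin d) ℝ →ₗ[ℝ] MvPolynomial (Fin d) ℝ :=
  LinearMap.mulLeft ℝ ((1 - rsq d) ^ 2) ∘ₗ lapP
    - (4 * a) • (LinearMap.mulLeft ℝ (1 - rsq d) ∘ₗ eulerP)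
    + (4 * a * (a - 1)) • LinearMap.mulLeft ℝ (rsq d)
    - (2 * a * d) • LinearMap.mulLeft ℝ (1 - rsq d)

theorem lapP_apply (p : MvPolynomial (Fin d) ℝ) : lapP p = ∑ i, pderiv i (pderiv i p) := by
  simp [lapP]

theorem eulerP_apply (p : MvPolynomial (Fin d) ℝ) : eulerP p = ∑ i, X i * pderiv i p := by
  simp [eulerP]

theorem angP_apply (i j : Fin d) (p : MvPolynomial (Fin d) ℝ) :
    angP i j p = X i * pderiv j p - X j * pderiv i p := by
  simp [angP]

theorem lbP_apply (p : MvPolynomial (Fin d) ℝ) :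
    lbP p = ∑ z : Fin d × Fin d with z.1 < z.2, angP z.1 z.2 (angP z.1 z.2 p) := by
  simp [lbP]

theorem adjP_apply (a : ℝ) (q : MvPolynomial (Fin d) ℝ) :
    adjP a q = (1 - rsq d) ^ 2 * lapP q - (4 * a) • ((1 - rsq d) * eulerP q)
      + (4 * a * (a - 1)) • (rsq d * q) - (2 * a * d) • ((1 - rsq d) * q) := by
  simp [adjP]

/-- The commutator of two derivations is a derivation, and this one vanishes on the variables. -/
theorem pderiv_pderiv_comm (i j : Fin d) (p : MvPolynomial (Fin d) ℝ) :
    pderiv i (pderiv j p) = pderiv j (pderiv i p) := by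
  have h : ⁅(pderiv i : Derivation ℝ (MvPolynomial (Fin d) ℝ) (MvPolynomial (Fin d) ℝ)),
      (pderiv j : Derivation ℝ (MvPolynomial (Fin d) ℝ) (MvPolynomial (Fin d) ℝ))⁆ = 0 := by
    refine MvPolynomial.derivation_ext fun k => ?_
    simp only [Derivation.commutator_apply, pderiv_X, Derivation.coe_zero, Pi.zero_apply,
      Pi.single_apply]
    split_ifs <;> simp
  have := congrArg (fun D => D p) h
  simpa [Derivation.commutator_apply, sub_eq_zero] using this

theorem two_mul_sum_lt {M : Type*} [AddCommGroup M] (F : Fin d → Fin d → M)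
    (hs : ∀ i j, F i j = F j i) (h0 : ∀ i, F i i = 0) :
    2 • ∑ z : Fin d × Fin d with z.1 < z.2, F z.1 z.2 = ∑ i, ∑ j, F i j := by
  have h1 : ∑ z : Fin d × Fin d with z.1 < z.2, F z.1 z.2
      = ∑ i, ∑ j, if i < j then F i j else 0 := by
    rw [Finset.sum_filter, Fintype.sum_prod_type]
  have h2 : ∑ z : Fin d × Fin d with z.1 < z.2, F z.1 z.2
      = ∑ i, ∑ j, if j < i then F i j else 0 := by
    rw [h1, Finset.sum_comm]
    refine Finset.sum_congr rfl fun i _ => Finset.sum_congr rfl fun j _ => ?_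
    rw [hs]
  rw [two_nsmul]
  nth_rewrite 1 [h1]
  rw [h2, ← Finset.sum_add_distrib]
  refine Finset.sum_congr rfl fun i _ => ?_
  rw [← Finset.sum_add_distrib]
  refine Finset.sum_congr rfl fun j _ => ?_
  rcases lt_trichotomy i j with h | h | h
  · simp [h, h.le]
  · subst h; simp [h0]
  · simp [h, h.le]

/-- The correction for `i = j` makes the formula valid on the diagonal, so that the sum over `i < j`
can be evaluated as half of the full double sum. -/
theorem angP_angP (i j : Fin d) (p : MvPolynomial (Fin d) ℝ) :
    angP i j (angP i j p) = X i ^ 2 * pderiv j (pderiv j p) + X j ^ 2 * pderiv i (pderiv i p)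
      - X i * pderiv i p - X j * pderiv j p - 2 * (X i * (X j * pderiv i (pderiv j p)))
      + (if i = j then X i * pderiv j p + X j * pderiv i p else 0) := by
  simp only [angP_apply, map_sub, pderiv_mul, pderiv_X, Pi.single_apply]
  rw [pderiv_pderiv_comm j i]
  by_cases h : i = j
  · subst h; simp; ring
  · simp [h, Ne.symm h]; ring

theorem eulerP_eulerP (p : MvPolynomial (Fin d) ℝ) :
    eulerP (eulerP p) = (∑ i, ∑ j, X i * (X j * pderiv i (pderiv j p))) + eulerP p := by
  simp only [eulerP_apply, map_sum, pderiv_mul, pderiv_X, Pi.single_apply]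
  rw [← Finset.sum_add_distrib]
  refine Finset.sum_congr rfl fun i _ => ?_
  simp only [mul_add, Finset.sum_add_distrib]
  rw [add_comm]
  congr 1
  · refine Finset.sum_congr rfl fun j _ => ?_
    rw [pderiv_pderiv_comm]
    ring
  · simp

/-- The Laplacian in polar coordinates: with `E = r ∂_r` the Euler operator, `r² Δ = E² + (d - 2) E
+ Δ_0`. Twice the identity is proved first, by symmetrizing the sum over `i < j`. -/
theorem rsq_mul_lapP (p : MvPolynomial (Fin d) ℝ) :
    rsq d * lapP p = eulerP (eulerP p) + ((d : ℝ) - 2) • eulerP p + lbP p := by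
  have h := two_mul_sum_lt (fun i j => angP i j (angP i j p))
    (fun i j => by
      simp only [angP_angP, pderiv_pderiv_comm j i, eq_comm (a := j)]
      by_cases h : i = j
      · subst h; rfl
      · simp [h]; ring)
    (fun i => by simp [angP_apply])
  rw [← lbP_apply] at h
  have h2 : ∑ i : Fin d, ∑ j, angP i j (angP i j p) =
      2 * (rsq d * lapP p) - 2 * (d : MvPolynomial (Fin d) ℝ) * eulerP p
        - 2 * (∑ i, ∑ j, X i * (X j * pderiv i (pderiv j p))) + 2 * eulerP p := by
    simp only [angP_angP, Finset.sum_add_distrib, Finset.sum_sub_distrib, Finset.sum_const,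
      Finset.card_univ, Fintype.card_fin, Finset.sum_ite_eq, Finset.mem_univ, if_true,
      ← Finset.mul_sum, ← Finset.sum_mul, ← eulerP_apply, ← lapP_apply,
      nsmul_eq_mul]
    rw [rsq]
    ring
  have h3 : (2 : MvPolynomial (Fin d) ℝ) * (rsq d * lapP p) =
      2 * (eulerP (eulerP p) + ((d : ℝ) - 2) • eulerP p + lbP p) := by
    rw [h2, two_nsmul, ← two_mul] at h
    rw [mul_add 2 _ (lbP p), h, eulerP_eulerP, sub_smul]
    simp only [MvPolynomial.smul_eq_C_mul, map_natCast, map_ofNat]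
    ring
  exact mul_left_cancel₀ two_ne_zero h3

theorem pderiv_pderiv_angP (i j k : Fin d) (p : MvPolynomial (Fin d) ℝ) :
    pderiv k (pderiv k (angP i j p)) = angP i j (pderiv k (pderiv k p))
      + 2 * ((if i = k then pderiv k (pderiv j p) else 0)
        - (if j = k then pderiv k (pderiv i p) else 0)) := by
  simp only [angP_apply, map_sub, map_add, pderiv_mul, pderiv_X, Pi.single_apply]
  rw [pderiv_pderiv_comm k j p, pderiv_pderiv_comm k i p, pderiv_pderiv_comm k j (pderiv k p),
    pderiv_pderiv_comm k i (pderiv k p)]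
  split_ifs <;> simp <;> ring

/-- The Laplacian is rotation invariant, and the angular derivatives generate the rotations. -/
theorem lapP_angP (i j : Fin d) (p : MvPolynomial (Fin d) ℝ) :
    lapP (angP i j p) = angP i j (lapP p) := by
  simp only [lapP_apply, pderiv_pderiv_angP, map_sum, Finset.sum_add_distrib, ← Finset.mul_sum,
    Finset.sum_sub_distrib, Finset.sum_ite_eq, Finset.mem_univ, if_true]
  rw [pderiv_pderiv_comm i j]
  simp

theorem lapP_lbP (p : MvPolynomial (Fin d) ℝ) : lapP (lbP p) = lbP (lapP p) := by
  simp only [lbP_apply, map_sum, lapP_angP]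

end Poly

/-! ### Degrees -/

section Degree

open MvPolynomial

variable {d : ℕ}

/-- The polynomials of total degree less than `m`. -/
noncomputable def degLT (d m : ℕ) : Submodule ℝ (MvPolynomial (Fin d) ℝ) :=
  restrictSupport ℝ {a | a.degree < m}

theorem degLT_succ (d m : ℕ) : degLT d (m + 1) = restrictTotalDegree (Fin d) ℝ m := by
  simp only [degLT, restrictTotalDegree, Nat.lt_succ_iff]
  rfl

theorem degLT_mono {m n : ℕ} (h : m ≤ n) : degLT d m ≤ degLT d n :=
  restrictSupport_mono _ fun _ ha => lt_of_lt_of_le ha h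

/-- The strict bound on the degree makes the filtration start at the zero space, as the construction
of the orthonormal basis requires. -/
theorem degLT_zero : degLT d 0 = ⊥ := by
  simp [degLT, restrictSupport_eq_span]

instance (m : ℕ) : Module.Finite ℝ (degLT d m) := by
  cases m with
  | zero => rw [degLT_zero]; infer_instance
  | succ m => rw [degLT_succ]; infer_instance

theorem exists_mem_degLT (p : MvPolynomial (Fin d) ℝ) : ∃ m, p ∈ degLT d (m + 1) :=
  ⟨p.totalDegree, by rw [degLT_succ, mem_restrictTotalDegree]⟩

theorem map_mem_of_monomial {m : ℕ} {N : Submodule ℝ (MvPolynomial (Fin d) ℝ)}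
    (T : MvPolynomial (Fin d) ℝ →ₗ[ℝ] MvPolynomial (Fin d) ℝ)
    (h : ∀ a : Fin d →₀ ℕ, a.degree < m → T (monomial a 1) ∈ N)
    {p : MvPolynomial (Fin d) ℝ} (hp : p ∈ degLT d m) : T p ∈ N := by
  have : degLT d m ≤ N.comap T := by
    rw [degLT, restrictSupport_eq_span, Submodule.span_le]
    rintro _ ⟨a, ha, rfl⟩
    exact h a ha
  exact this hp

theorem X_mul_mem_degLT {m : ℕ} (i : Fin d) {p : MvPolynomial (Fin d) ℝ} (hp : p ∈ degLT d m) :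
    X i * p ∈ degLT d (m + 1) := by
  refine map_mem_of_monomial (LinearMap.mulLeft ℝ (X i)) (fun a ha => ?_) hp
  rw [LinearMap.mulLeft_apply, X, monomial_mul, degLT, monomial_mem_restrictSupport]
  left
  simp only [Set.mem_ofPred_eq, map_add, Finsupp.degree_single]
  omega

theorem pderiv_mem_degLT {m : ℕ} (i : Fin d) {p : MvPolynomial (Fin d) ℝ}
    (hp : p ∈ degLT d (m + 1)) : pderiv i p ∈ degLT d m := by
  refine map_mem_of_monomial (pderiv i).toLinearMap (fun a ha => ?_) hp
  rw [Derivation.coeFn_coe, pderiv_monomial, degLT, monomial_mem_restrictSupport]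
  by_cases h : a i = 0
  · right; simp [h]
  · left
    have h1 : a = (a - Finsupp.single i 1) + Finsupp.single i 1 := by
      rw [tsub_add_cancel_of_le]
      rw [Finsupp.single_le_iff]; omega
    rw [h1, map_add, Finsupp.degree_single] at ha
    simp only [Set.mem_ofPred_eq]
    omega

theorem rsq_mul_mem_degLT {m : ℕ} {p : MvPolynomial (Fin d) ℝ} (hp : p ∈ degLT d m) :
    rsq d * p ∈ degLT d (m + 2) := by
  rw [rsq, Finset.sum_mul]
  refine Submodule.sum_mem _ fun i _ => ?_
  rw [pow_two, mul_assoc]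
  exact X_mul_mem_degLT i (X_mul_mem_degLT i hp)

theorem lapP_mem_degLT {m : ℕ} {p : MvPolynomial (Fin d) ℝ} (hp : p ∈ degLT d (m + 2)) :
    lapP p ∈ degLT d m := by
  rw [lapP_apply]
  exact Submodule.sum_mem _ fun i _ => pderiv_mem_degLT i (pderiv_mem_degLT i hp)

theorem eulerP_monomial (a : Fin d →₀ ℕ) :
    eulerP (monomial a (1 : ℝ)) = (a.degree : ℝ) • monomial a 1 := by
  rw [eulerP_apply, (isHomogeneous_monomial (1 : ℝ) (rfl : a.degree = a.degree)).sum_X_mul_pderiv,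
    Nat.cast_smul_eq_nsmul]

theorem eulerP_mem_degLT {m : ℕ} {p : MvPolynomial (Fin d) ℝ} (hp : p ∈ degLT d m) :
    eulerP p ∈ degLT d m := by
  refine map_mem_of_monomial eulerP (fun a ha => ?_) hp
  rw [eulerP_monomial]
  refine Submodule.smul_mem _ _ ?_
  rw [degLT, monomial_mem_restrictSupport]
  exact Or.inl ha

theorem eulerP_sub_mem_degLT {m : ℕ} {p : MvPolynomial (Fin d) ℝ} (hp : p ∈ degLT d (m + 1)) :
    eulerP p - (m : ℝ) • p ∈ degLT d m := by
  refine map_mem_of_monomial (eulerP - (m : ℝ) • LinearMap.id) (fun a ha => ?_) hp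
  rw [LinearMap.sub_apply, eulerP_monomial, LinearMap.smul_apply, LinearMap.id_apply, ← sub_smul]
  by_cases h : a.degree = m
  · simp [h]
  · refine Submodule.smul_mem _ _ ?_
    rw [degLT, monomial_mem_restrictSupport]
    exact Or.inl (show a.degree < m by omega)

theorem angP_mem_degLT {m : ℕ} (i j : Fin d) {p : MvPolynomial (Fin d) ℝ} (hp : p ∈ degLT d m) :
    angP i j p ∈ degLT d m := by
  cases m with
  | zero =>
    rw [degLT_zero, Submodule.mem_bot] at hp ⊢
    rw [hp, map_zero]
  | succ m =>
    rw [angP_apply]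
    exact Submodule.sub_mem _ (X_mul_mem_degLT _ (pderiv_mem_degLT _ hp))
      (X_mul_mem_degLT _ (pderiv_mem_degLT _ hp))

theorem lbP_mem_degLT {m : ℕ} {p : MvPolynomial (Fin d) ℝ} (hp : p ∈ degLT d m) :
    lbP p ∈ degLT d m := by
  rw [lbP_apply]
  exact Submodule.sum_mem _ fun z _ => angP_mem_degLT _ _ (angP_mem_degLT _ _ hp)

/-- In the polar form every term preserves degrees, which covers small `m` without a case
distinction. -/
theorem rsq_mul_lapP_mem_degLT {m : ℕ} {p : MvPolynomial (Fin d) ℝ} (hp : p ∈ degLT d m) :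
    rsq d * lapP p ∈ degLT d m := by
  rw [rsq_mul_lapP]
  exact Submodule.add_mem _ (Submodule.add_mem _ (eulerP_mem_degLT (eulerP_mem_degLT hp))
    (Submodule.smul_mem _ _ (eulerP_mem_degLT hp))) (lbP_mem_degLT hp)

theorem lapP_mem_degLT_self {m : ℕ} {p : MvPolynomial (Fin d) ℝ} (hp : p ∈ degLT d m) :
    lapP p ∈ degLT d m :=
  lapP_mem_degLT (degLT_mono (Nat.le_add_right m 2) hp)

/-- On the leading part of degree `m` the Euler operator is multiplication by `m`, so the polar form
acts there by `m² + (d - 2) m - c`. -/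
theorem rsq_mul_lapP_sub_mem_degLT {m : ℕ} {c : ℝ} {p : MvPolynomial (Fin d) ℝ}
    (hp : p ∈ degLT d (m + 1)) (hc : lbP p = -c • p) :
    rsq d * lapP p - ((m : ℝ) * (m + d - 2) - c) • p ∈ degLT d m := by
  have h1 := eulerP_sub_mem_degLT hp
  have h2 := eulerP_mem_degLT h1
  have e : rsq d * lapP p - ((m : ℝ) * (m + d - 2) - c) • p =
      eulerP (eulerP p - (m : ℝ) • p) + ((m : ℝ) + d - 2) • (eulerP p - (m : ℝ) • p) := by
    rw [rsq_mul_lapP, hc, map_sub, map_smul]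
    module
  rw [e]
  exact Submodule.add_mem _ h2 (Submodule.smul_mem _ _ h1)

/-- Grouping the terms as `rsq d * lapP q` shows that the degree grows by at most two, instead of
the four suggested by `(1 - rsq d) ^ 2`. -/
theorem adjP_eq (a : ℝ) (q : MvPolynomial (Fin d) ℝ) :
    adjP a q = lapP q - 2 • (rsq d * lapP q) + rsq d * (rsq d * lapP q)
      - (4 * a) • eulerP q + (4 * a) • (rsq d * eulerP q)
      + (4 * a * (a - 1) + 2 * a * d) • (rsq d * q) - (2 * a * d) • q := by
  rw [adjP_apply, add_smul]
  simp only [MvPolynomial.smul_eq_C_mul, nsmul_eq_mul]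
  push_cast
  ring

theorem adjP_mem_degLT {m : ℕ} (a : ℝ) {q : MvPolynomial (Fin d) ℝ} (hq : q ∈ degLT d m) :
    adjP a q ∈ degLT d (m + 2) := by
  have hm : degLT d m ≤ degLT d (m + 2) := degLT_mono (Nat.le_add_right m 2)
  rw [adjP_eq]
  have h1 := rsq_mul_lapP_mem_degLT hq
  refine Submodule.sub_mem _ (Submodule.add_mem _ (Submodule.add_mem _ (Submodule.sub_mem _
    (Submodule.add_mem _ (Submodule.sub_mem _ (hm (lapP_mem_degLT_self hq)) ?_) ?_) ?_) ?_) ?_) ?_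
  · exact Submodule.smul_of_tower_mem _ _ (hm h1)
  · exact rsq_mul_mem_degLT h1
  · exact Submodule.smul_mem _ _ (hm (eulerP_mem_degLT hq))
  · exact Submodule.smul_mem _ _ (rsq_mul_mem_degLT (eulerP_mem_degLT hq))
  · exact Submodule.smul_mem _ _ (rsq_mul_mem_degLT hq)
  · exact Submodule.smul_mem _ _ (hm hq)

/-- The top-order coefficient of `rsq d * q` is `M (M + d - 2) - c + 4 a M + 4 a (a - 1) + 2 a d`,
which factors as stated. -/
theorem adjP_sub_mem_degLT {M : ℕ} (a c : ℝ) {q : MvPolynomial (Fin d) ℝ}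
    (hq : q ∈ degLT d (M + 1)) (hc : lbP q = -c • q) :
    adjP a q - (((M : ℝ) + 2 * a) * (M + 2 * a + d - 2) - c) • (rsq d * q) ∈ degLT d (M + 2) := by
  have hm : degLT d (M + 1) ≤ degLT d (M + 2) := degLT_mono (Nat.le_succ _)
  have h1 := rsq_mul_lapP_mem_degLT hq
  have h2 := rsq_mul_mem_degLT (rsq_mul_lapP_sub_mem_degLT hq hc)
  have h3 := rsq_mul_mem_degLT (eulerP_sub_mem_degLT hq)
  have e : adjP a q - (((M : ℝ) + 2 * a) * (M + 2 * a + d - 2) - c) • (rsq d * q) =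
      lapP q - 2 • (rsq d * lapP q) + rsq d * (rsq d * lapP q - ((M : ℝ) * (M + d - 2) - c) • q)
      - (4 * a) • eulerP q + (4 * a) • (rsq d * (eulerP q - (M : ℝ) • q)) - (2 * a * d) • q := by
    simp only [adjP_eq, mul_sub (rsq d), mul_smul_comm]
    module
  rw [e]
  refine Submodule.sub_mem _ (Submodule.add_mem _ (Submodule.sub_mem _ (Submodule.add_mem _
    (Submodule.sub_mem _ (hm (lapP_mem_degLT_self hq)) ?_) h2) ?_) (Submodule.smul_mem _ _ h3)) ?_
  · exact Submodule.smul_of_tower_mem _ _ (hm h1)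
  · exact Submodule.smul_mem _ _ (hm (eulerP_mem_degLT hq))
  · exact Submodule.smul_mem _ _ (hm hq)

/-- The factor by which `adjP (α + 2) ∘ lapP` acts on the leading part, of degree `m`, of an
eigenvector of the Laplace-Beltrami operator for the eigenvalue `-c`. -/
noncomputable def lapFactor (d : ℕ) (α : ℝ) (m : ℕ) (c : ℝ) : ℝ :=
  ((m : ℝ) * (m + d - 2) - c) * ((m + 2 * α + 2) * (m + 2 * α + d) - c)

theorem adjP_lapP_sub_mem_degLT {M : ℕ} (α c : ℝ) {p : MvPolynomial (Fin d) ℝ}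
    (hp : p ∈ degLT d (M + 2 + 1)) (hc : lbP p = -c • p) :
    adjP (α + 2) (lapP p) - lapFactor d α (M + 2) c • p ∈ degLT d (M + 2) := by
  have hq : lapP p ∈ degLT d (M + 1) := lapP_mem_degLT hp
  have hcq : lbP (lapP p) = -c • lapP p := by rw [← lapP_lbP, hc, map_smul]
  have h1 := adjP_sub_mem_degLT (α + 2) c hq hcq
  have h2 := Submodule.smul_mem _ (((M : ℝ) + 2 * (α + 2)) * (M + 2 * (α + 2) + d - 2) - c)
    (rsq_mul_lapP_sub_mem_degLT hp hc)
  have := Submodule.add_mem _ h1 h2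
  rw [lapFactor]
  convert! this using 1
  push_cast
  module

end Degree

/-! ### Partial derivatives of smooth functions and test functions -/

section Test

variable {d : ℕ}

theorem contDiff_partialD (i : Fin d) {φ : EuclideanSpace ℝ (Fin d) → ℝ} (h : ContDiff ℝ ∞ φ) :
    ContDiff ℝ ∞ (partialD i φ) :=
  (h.fderiv_right (m := ∞) le_rfl).clm_apply contDiff_const

theorem partialD_comm (i j : Fin d) {φ : EuclideanSpace ℝ (Fin d) → ℝ} (h : ContDiff ℝ ∞ φ) :
    partialD i (partialD j φ) = partialD j (partialD i φ) := by
  have hd : Differentiable ℝ (fderiv ℝ φ) :=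
    (h.fderiv_right (m := ∞) le_rfl).differentiable (by simp)
  have key : ∀ (i j : Fin d) (x : EuclideanSpace ℝ (Fin d)), partialD i (partialD j φ) x =
      fderiv ℝ (fderiv ℝ φ) x (EuclideanSpace.single i 1) (EuclideanSpace.single j 1) := by
    intro i j x
    change fderiv ℝ (fun y => fderiv ℝ φ y (EuclideanSpace.single j 1)) x _ = _
    rw [fderiv_clm_apply (hd x) (differentiableAt_const _)]
    simp
  funext x
  rw [key, key]
  exact (h.contDiffAt.isSymmSndFDerivAt
    (by rw [minSmoothness_of_isRCLikeNormedField]; exact WithTop.coe_le_coe.2 (le_top : (2 : ℕ∞) ≤ ⊤))).eq _ _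

theorem partialD_add (i : Fin d) {φ ψ : EuclideanSpace ℝ (Fin d) → ℝ} (hφ : ContDiff ℝ ∞ φ)
    (hψ : ContDiff ℝ ∞ ψ) :
    partialD i (fun x => φ x + ψ x) = fun x => partialD i φ x + partialD i ψ x := by
  funext x
  simp only [partialD]
  rw [fderiv_fun_add (hφ.differentiable (by simp) x) (hψ.differentiable (by simp) x)]
  rfl

theorem partialD_mul (i : Fin d) {φ ψ : EuclideanSpace ℝ (Fin d) → ℝ} (hφ : ContDiff ℝ ∞ φ)
    (hψ : ContDiff ℝ ∞ ψ) :
    partialD i (fun x => φ x * ψ x) = fun x => partialD i φ x * ψ x + φ x * partialD i ψ x := by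
  funext x
  simp only [partialD]
  rw [fderiv_fun_mul (hφ.differentiable (by simp) x) (hψ.differentiable (by simp) x)]
  simp
  ring

theorem contDiff_coord (i : Fin d) : ContDiff ℝ ∞ fun x : EuclideanSpace ℝ (Fin d) => x i := by
  fun_prop

theorem partialD_coord (i j : Fin d) :
    partialD i (fun x : EuclideanSpace ℝ (Fin d) => x j) = fun _ => if i = j then 1 else 0 := by
  funext x
  have : (fun x : EuclideanSpace ℝ (Fin d) => x j) = EuclideanSpace.proj (𝕜 := ℝ) j := rfl
  simp only [partialD]
  rw [this, ContinuousLinearMap.fderiv]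
  simp [eq_comm]

theorem partialD_pev (i : Fin d) (p : MvPolynomial (Fin d) ℝ) :
    partialD i (pev p) = pev (MvPolynomial.pderiv i p) := by
  induction p using MvPolynomial.induction_on with
  | C a =>
    rw [show pev (MvPolynomial.C a) = fun _ : EuclideanSpace ℝ (Fin d) => a from
      funext fun x => pev_C a x]
    funext x
    simp [partialD]
  | add p q hp hq =>
    rw [show pev (p + q) = fun x => pev p x + pev q x from funext fun x => pev_add p q x,
      partialD_add i (contDiff_pev p) (contDiff_pev q), hp, hq]
    funext x
    simp
  | mul_X p j hp =>
    rw [show pev (p * MvPolynomial.X j) = fun x => pev p x * x j from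
      funext fun x => by simp, partialD_mul i (contDiff_pev p) (contDiff_coord j), hp,
      partialD_coord]
    funext x
    simp only [MvPolynomial.pderiv_mul, MvPolynomial.pderiv_X, pev_add, pev_mul, pev_X,
      Pi.single_apply]
    by_cases hij : i = j
    · subst hij
      rw [if_pos rfl, if_pos rfl, ← MvPolynomial.C_1, pev_C]
    · rw [if_neg hij, if_neg (Ne.symm hij), pev_zero]

theorem IsTest.partialD {φ : EuclideanSpace ℝ (Fin d) → ℝ} (h : IsTest φ) (i : Fin d) :
    IsTest (partialD i φ) where
  smooth := contDiff_partialD i h.smooth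
  compact := h.compact.fderiv_apply (𝕜 := ℝ) _
  support := (tsupport_fderiv_apply_subset ℝ _).trans h.support

theorem IsTest.smooth_mul {φ ψ : EuclideanSpace ℝ (Fin d) → ℝ} (h : IsTest φ)
    (hψ : ContDiff ℝ ∞ ψ) : IsTest fun x => ψ x * φ x where
  smooth := hψ.mul h.smooth
  compact := h.compact.mul_left
  support := (tsupport_mul_subset_right (f := ψ)).trans h.support

theorem IsTest.add {φ ψ : EuclideanSpace ℝ (Fin d) → ℝ} (h : IsTest φ) (h' : IsTest ψ) :
    IsTest fun x => φ x + ψ x where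
  smooth := h.smooth.add h'.smooth
  compact := h.compact.add h'.compact
  support := (tsupport_add φ ψ).trans (Set.union_subset h.support h'.support)

theorem IsTest.sub {φ ψ : EuclideanSpace ℝ (Fin d) → ℝ} (h : IsTest φ) (h' : IsTest ψ) :
    IsTest fun x => φ x - ψ x := by
  simpa [sub_eq_add_neg] using h.add (h'.smooth_mul (ψ := fun _ => -1) contDiff_const)

theorem isTest_zero : IsTest fun _ : EuclideanSpace ℝ (Fin d) => (0 : ℝ) where
  smooth := contDiff_const
  compact := HasCompactSupport.zero (β := ℝ)
  support := by simp [tsupport, Function.support]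

theorem IsTest.sum {ι : Type*} {t : Finset ι} {φ : ι → EuclideanSpace ℝ (Fin d) → ℝ}
    (h : ∀ i ∈ t, IsTest (φ i)) : IsTest fun x => ∑ i ∈ t, φ i x := by
  classical
  induction t using Finset.induction_on with
  | empty => simpa using isTest_zero
  | insert a t ha ih =>
    simp only [Finset.sum_insert ha]
    exact (h a (by simp)).add (ih fun i hi => h i (by simp [hi]))

theorem IsTest.eq_zero {φ : EuclideanSpace ℝ (Fin d) → ℝ} (h : IsTest φ)
    {x : EuclideanSpace ℝ (Fin d)} (hx : x ∉ Metric.ball 0 1) : φ x = 0 :=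
  image_eq_zero_of_notMem_tsupport fun h' => hx (h.support h')

theorem IsTest.integrable_mul {φ f : EuclideanSpace ℝ (Fin d) → ℝ} (h : IsTest φ)
    (hf : LocallyIntegrableOn f (Metric.ball 0 1) volume) :
    Integrable fun x => f x * φ x := by
  have hK : IsCompact (tsupport φ) := h.compact
  have e : (tsupport φ).indicator (fun x => f x * φ x) = fun x => f x * φ x := by
    refine Set.indicator_eq_self.2 (Function.support_subset_iff'.2 fun x hx => ?_)
    simp [image_eq_zero_of_notMem_tsupport hx]
  rw [← e, integrable_indicator_iff hK.measurableSet]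
  exact (hf.integrableOn_compact_subset h.support hK).mul_continuousOn
    h.smooth.continuous.continuousOn hK

theorem IsTest.integral_congr {φ f g : EuclideanSpace ℝ (Fin d) → ℝ} (h : IsTest φ)
    (hfg : f =ᵐ[volume.restrict (Metric.ball 0 1)] g) :
    ∫ x, f x * φ x = ∫ x, g x * φ x := by
  have key : ∀ f : EuclideanSpace ℝ (Fin d) → ℝ,
      ∫ x in Metric.ball 0 1, f x * φ x = ∫ x, f x * φ x := fun f =>
    setIntegral_eq_integral_of_forall_compl_eq_zero fun x hx => by simp [h.eq_zero hx]
  rw [← key f, ← key g]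
  refine MeasureTheory.integral_congr_ae ?_
  filter_upwards [hfg] with x hx
  rw [hx]

/-- The classical Laplace operator. -/
noncomputable def lapC (φ : EuclideanSpace ℝ (Fin d) → ℝ) : EuclideanSpace ℝ (Fin d) → ℝ :=
  fun x => ∑ i, partialD i (partialD i φ) x

/-- The classical angular derivative. -/
noncomputable def angC (i j : Fin d) (φ : EuclideanSpace ℝ (Fin d) → ℝ) :
    EuclideanSpace ℝ (Fin d) → ℝ :=
  fun x => x i * partialD j φ x - x j * partialD i φ x

/-- The classical Laplace-Beltrami operator. -/
noncomputable def lbC (φ : EuclideanSpace ℝ (Fin d) → ℝ) : EuclideanSpace ℝ (Fin d) → ℝ :=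
  fun x => ∑ z : Fin d × Fin d with z.1 < z.2, angC z.1 z.2 (angC z.1 z.2 φ) x

theorem IsTest.angC {φ : EuclideanSpace ℝ (Fin d) → ℝ} (h : IsTest φ) (i j : Fin d) :
    IsTest (angC i j φ) :=
  ((h.partialD j).smooth_mul (contDiff_coord i)).sub ((h.partialD i).smooth_mul (contDiff_coord j))

theorem IsTest.lapC {φ : EuclideanSpace ℝ (Fin d) → ℝ} (h : IsTest φ) : IsTest (lapC φ) :=
  IsTest.sum fun i _ => (h.partialD i).partialD i

theorem IsTest.lbC {φ : EuclideanSpace ℝ (Fin d) → ℝ} (h : IsTest φ) : IsTest (lbC φ) :=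
  IsTest.sum fun z _ => (h.angC z.1 z.2).angC z.1 z.2

theorem IsTest.lbC_iterate {φ : EuclideanSpace ℝ (Fin d) → ℝ} (h : IsTest φ) (s : ℕ) :
    IsTest (BallApprox.lbC^[s] φ) := by
  induction s with
  | zero => exact h
  | succ s ih => rw [Function.iterate_succ_apply']; exact ih.lbC

end Test

/-! ### Multi-index derivatives of smooth functions -/

section Multi

variable {d : ℕ}

theorem contDiff_partialD_iterate (i : Fin d) (n : ℕ) {φ : EuclideanSpace ℝ (Fin d) → ℝ}
    (h : ContDiff ℝ ∞ φ) : ContDiff ℝ ∞ ((partialD i)^[n] φ) := by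
  induction n with
  | zero => exact h
  | succ n ih => rw [Function.iterate_succ_apply']; exact contDiff_partialD i ih

theorem partialD_iterate_comm (i j : Fin d) (n : ℕ) {φ : EuclideanSpace ℝ (Fin d) → ℝ}
    (h : ContDiff ℝ ∞ φ) :
    partialD i ((partialD j)^[n] φ) = (partialD j)^[n] (partialD i φ) := by
  induction n with
  | zero => rfl
  | succ n ih =>
    rw [Function.iterate_succ_apply', Function.iterate_succ_apply',
      partialD_comm i j (contDiff_partialD_iterate j n h), ih]

theorem contDiff_foldr (l : List (Fin d)) (m : Fin d → ℕ) {φ : EuclideanSpace ℝ (Fin d) → ℝ}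
    (h : ContDiff ℝ ∞ φ) :
    ContDiff ℝ ∞ (l.foldr (fun i ψ => (partialD i)^[m i] ψ) φ) := by
  induction l with
  | nil => exact h
  | cons a l ih => exact contDiff_partialD_iterate a _ ih

/-- An additional derivative in direction `i` is applied at the place of `i` in the list; since
partial derivatives commute, it can be moved to the outside. -/
theorem foldr_add_single (l : List (Fin d)) (hl : l.Nodup) (m : Fin d → ℕ) (i : Fin d)
    {φ : EuclideanSpace ℝ (Fin d) → ℝ} (h : ContDiff ℝ ∞ φ) :
    l.foldr (fun k ψ => (partialD k)^[(m + Pi.single i 1 : Fin d → ℕ) k] ψ) φ =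
      if i ∈ l then partialD i (l.foldr (fun k ψ => (partialD k)^[m k] ψ) φ)
      else l.foldr (fun k ψ => (partialD k)^[m k] ψ) φ := by
  induction l with
  | nil => simp
  | cons a l ih =>
    rw [List.nodup_cons] at hl
    rw [List.foldr_cons, List.foldr_cons, ih hl.2]
    by_cases hia : i = a
    · subst hia
      simp [hl.1, Function.iterate_succ_apply']
    · have h1 : (m + Pi.single i 1 : Fin d → ℕ) a = m a := by simp [Ne.symm hia]
      rw [h1]
      by_cases hil : i ∈ l
      · simp [hil, partialD_iterate_comm i a _ (contDiff_foldr l m h)]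
      · simp [hil, hia]

theorem multiD_add_single (m : Fin d → ℕ) (i : Fin d) {φ : EuclideanSpace ℝ (Fin d) → ℝ}
    (h : ContDiff ℝ ∞ φ) : multiD (m + Pi.single i 1) φ = partialD i (multiD m φ) := by
  rw [multiD, foldr_add_single _ (List.nodup_finRange d) m i h, if_pos (List.mem_finRange i)]
  rfl

theorem multiD_zero (φ : EuclideanSpace ℝ (Fin d) → ℝ) : multiD 0 φ = φ := by
  rw [multiD]
  generalize List.finRange d = l
  induction l with
  | nil => rfl
  | cons a l ih => simp

theorem multiD_single (i : Fin d) {φ : EuclideanSpace ℝ (Fin d) → ℝ}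
    (h : ContDiff ℝ ∞ φ) : multiD (Pi.single i 1) φ = partialD i φ := by
  rw [← zero_add (Pi.single i 1), multiD_add_single 0 i h, multiD_zero]

theorem IsTest.multiD {φ : EuclideanSpace ℝ (Fin d) → ℝ} (h : IsTest φ) (m : Fin d → ℕ) :
    IsTest (multiD m φ) := by
  rw [BallApprox.multiD]
  generalize List.finRange d = l
  induction l with
  | nil => exact h
  | cons a l ih =>
    rw [List.foldr_cons]
    generalize m a = n
    induction n with
    | zero => exact ih
    | succ n ih' => rw [Function.iterate_succ_apply']; exact ih'.partialD a

end Multi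

/-! ### Weak partial derivatives -/

section Weak

variable {d : ℕ}

theorem isWeakDeriv_single_iff {i : Fin d} {f g : EuclideanSpace ℝ (Fin d) → ℝ} :
    IsWeakDeriv (Pi.single i 1) f g ↔ LocallyIntegrableOn f (Metric.ball 0 1) volume ∧
      LocallyIntegrableOn g (Metric.ball 0 1) volume ∧
      ∀ φ, IsTest φ → ∫ x, f x * partialD i φ x = -∫ x, g x * φ x := by
  have e : ∀ φ : EuclideanSpace ℝ (Fin d) → ℝ, IsTest φ →
      ((∫ x, f x * multiD (Pi.single i 1) φ x =
        (-1) ^ (∑ k, (Pi.single i 1 : Fin d → ℕ) k) * ∫ x, g x * φ x) ↔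
      ∫ x, f x * partialD i φ x = -∫ x, g x * φ x) := by
    intro φ hφ
    rw [multiD_single i hφ.smooth, Finset.sum_pi_single']
    simp
  exact ⟨fun h => ⟨h.1, h.2, fun φ hφ => (e φ hφ).1 (h.3 φ hφ)⟩,
    fun h => ⟨h.1, h.2.1, fun φ hφ => (e φ hφ).2 (h.2.2 φ hφ)⟩⟩

theorem IsWeakDeriv.integral_partialD {i : Fin d} {f g φ : EuclideanSpace ℝ (Fin d) → ℝ}
    (h : IsWeakDeriv (Pi.single i 1) f g) (hφ : IsTest φ) :
    ∫ x, f x * partialD i φ x = -∫ x, g x * φ x :=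
  (isWeakDeriv_single_iff.1 h).2.2 φ hφ

/-- The fundamental lemma of the calculus of variations, applied to `g - g'`. -/
theorem IsWeakDeriv.ae_eq {m : Fin d → ℕ} {f g g' : EuclideanSpace ℝ (Fin d) → ℝ}
    (h : IsWeakDeriv m f g) (h' : IsWeakDeriv m f g') :
    g =ᵐ[volume.restrict (Metric.ball 0 1)] g' := by
  have h0 := Metric.isOpen_ball.ae_eq_zero_of_integral_contDiff_smul_eq_zero
    (h.locInt_deriv.sub h'.locInt_deriv) (fun φ h1 h2 h3 => by
      have hφ : IsTest φ := ⟨h1, h2, h3⟩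
      have e := (h.integral_eq φ hφ).symm.trans (h'.integral_eq φ hφ)
      have e2 := mul_left_cancel₀ (pow_ne_zero _ (by norm_num)) e
      simp only [Pi.sub_apply, smul_eq_mul, mul_sub]
      rw [integral_sub ((hφ.integrable_mul h.locInt_deriv).congr (ae_of_all _ fun x => mul_comm _ _))
        ((hφ.integrable_mul h'.locInt_deriv).congr (ae_of_all _ fun x => mul_comm _ _))]
      simp only [mul_comm (φ _)]
      rw [e2, sub_self])
  rw [Filter.EventuallyEq, ae_restrict_iff' Metric.isOpen_ball.measurableSet]
  filter_upwards [h0] with x hx hx'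
  exact sub_eq_zero.1 (hx hx')

theorem IsWeakDeriv.congr {m : Fin d → ℕ} {f f' g g' : EuclideanSpace ℝ (Fin d) → ℝ}
    (h : IsWeakDeriv m f g) (hf : f =ᵐ[volume.restrict (Metric.ball 0 1)] f')
    (hg : g =ᵐ[volume.restrict (Metric.ball 0 1)] g') : IsWeakDeriv m f' g' where
  locInt_fun := h.locInt_fun.congr hf
  locInt_deriv := h.locInt_deriv.congr hg
  integral_eq φ hφ := by
    rw [← (hφ.multiD m).integral_congr hf, ← hφ.integral_congr hg, h.integral_eq φ hφ]

theorem IsWeakDeriv.lin {i : Fin d} {f f' g g' : EuclideanSpace ℝ (Fin d) → ℝ}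
    (h : IsWeakDeriv (Pi.single i 1) f g) (h' : IsWeakDeriv (Pi.single i 1) f' g') (a b : ℝ) :
    IsWeakDeriv (Pi.single i 1) (fun x => a * f x + b * f' x) (fun x => a * g x + b * g' x) := by
  have key : ∀ {u v φ : EuclideanSpace ℝ (Fin d) → ℝ},
      LocallyIntegrableOn u (Metric.ball 0 1) volume →
      LocallyIntegrableOn v (Metric.ball 0 1) volume → IsTest φ →
      ∫ x, (a * u x + b * v x) * φ x = a * (∫ x, u x * φ x) + b * ∫ x, v x * φ x := by
    intro u v φ hu hv hφ
    simp only [add_mul, mul_assoc]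
    rw [integral_add ((hφ.integrable_mul hu).const_mul a) ((hφ.integrable_mul hv).const_mul b),
      integral_const_mul, integral_const_mul]
  rw [isWeakDeriv_single_iff]
  refine ⟨(h.locInt_fun.smul a).add (h'.locInt_fun.smul b),
    (h.locInt_deriv.smul a).add (h'.locInt_deriv.smul b), fun φ hφ => ?_⟩
  rw [key h.locInt_fun h'.locInt_fun (hφ.partialD i), key h.locInt_deriv h'.locInt_deriv hφ,
    h.integral_partialD hφ, h'.integral_partialD hφ]
  ring

theorem locallyIntegrableOn_coord_mul (j : Fin d) {f : EuclideanSpace ℝ (Fin d) → ℝ}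
    (h : LocallyIntegrableOn f (Metric.ball 0 1) volume) :
    LocallyIntegrableOn (fun x => x j * f x) (Metric.ball 0 1) volume := by
  exact h.continuousOn_mul (contDiff_coord j).continuous.continuousOn Metric.isOpen_ball.isLocallyClosed

/-- The Leibniz rule, obtained by testing `f` against `x j * φ`. The derivative is written as a
linear combination to fit `Reg.lin`. -/
theorem IsWeakDeriv.coord_mul {i j : Fin d} {f g : EuclideanSpace ℝ (Fin d) → ℝ}
    (h : IsWeakDeriv (Pi.single i 1) f g) :
    IsWeakDeriv (Pi.single i 1) (fun x => x j * f x)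
      (fun x => (if i = j then 1 else 0) * f x + 1 * (x j * g x)) := by
  have hf := locallyIntegrableOn_coord_mul j h.locInt_fun
  have hg := locallyIntegrableOn_coord_mul j h.locInt_deriv
  rw [isWeakDeriv_single_iff]
  refine ⟨hf, (h.locInt_fun.smul (if i = j then (1 : ℝ) else 0)).add (hg.smul (1 : ℝ)),
    fun φ hφ => ?_⟩
  have h1 := h.integral_partialD (hφ.smooth_mul (contDiff_coord j))
  rw [partialD_mul i (contDiff_coord j) hφ.smooth, partialD_coord] at h1
  have e1 : ∀ x, f x * ((if i = j then 1 else 0) * φ x + x j * partialD i φ x) =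
      (if i = j then 1 else 0) * (f x * φ x) + x j * f x * partialD i φ x := fun x => by ring
  have e2 : ∀ x, ((if i = j then 1 else 0) * f x + 1 * (x j * g x)) * φ x =
      (if i = j then 1 else 0) * (f x * φ x) + x j * g x * φ x := fun x => by ring
  have e3 : ∀ x, g x * (x j * φ x) = x j * g x * φ x := fun x => by ring
  simp only [e1, e2, e3] at h1 ⊢
  rw [integral_add ((hφ.integrable_mul h.locInt_fun).const_mul _)
    ((hφ.partialD i).integrable_mul hf)] at h1
  rw [integral_add ((hφ.integrable_mul h.locInt_fun).const_mul _) (hφ.integrable_mul hg)]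
  linarith

/-- Functions with weak partial derivatives up to order `k`, those of order `l` lying in the
weighted space with exponent `α + l`. -/
def Reg (d : ℕ) : ℕ → ℝ → (EuclideanSpace ℝ (Fin d) → ℝ) → Prop
  | 0, α, f => LocallyIntegrableOn f (Metric.ball 0 1) volume ∧ MemLp f 2 (weightMeasure d α)
  | k + 1, α, f => (LocallyIntegrableOn f (Metric.ball 0 1) volume ∧
      MemLp f 2 (weightMeasure d α)) ∧
      ∀ i, ∃ g, IsWeakDeriv (Pi.single i 1) f g ∧ Reg d k (α + 1) g

variable {k : ℕ} {α : ℝ} {f g : EuclideanSpace ℝ (Fin d) → ℝ}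

theorem Reg.locInt (h : Reg d k α f) : LocallyIntegrableOn f (Metric.ball 0 1) volume := by
  cases k with
  | zero => exact h.1
  | succ k => exact h.1.1

theorem Reg.memLp (h : Reg d k α f) : MemLp f 2 (weightMeasure d α) := by
  cases k with
  | zero => exact h.2
  | succ k => exact h.1.2

theorem Reg.congr (h : Reg d k α f) (hfg : f =ᵐ[volume.restrict (Metric.ball 0 1)] g) :
    Reg d k α g := by
  have h1 : LocallyIntegrableOn g (Metric.ball 0 1) volume := h.locInt.congr hfg
  have h2 : MemLp g 2 (weightMeasure d α) :=
    (memLp_congr_ae (weightMeasure_absolutelyContinuous.ae_le hfg)).1 h.memLp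
  cases k with
  | zero => exact ⟨h1, h2⟩
  | succ k =>
    refine ⟨⟨h1, h2⟩, fun i => ?_⟩
    obtain ⟨u, hu, hu'⟩ := h.2 i
    exact ⟨u, hu.congr hfg (ae_eq_refl u), hu'⟩

theorem Reg.mono {β : ℝ} (h : Reg d k α f) (hαβ : α ≤ β) : Reg d k β f := by
  induction k generalizing α β f with
  | zero => exact ⟨h.1, h.2.mono_measure (weightMeasure_mono hαβ)⟩
  | succ k ih =>
    refine ⟨⟨h.1.1, h.1.2.mono_measure (weightMeasure_mono hαβ)⟩, fun i => ?_⟩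
    obtain ⟨u, hu, hu'⟩ := h.2 i
    exact ⟨u, hu, ih hu' (by linarith)⟩

theorem Reg.pred (h : Reg d (k + 1) α f) : Reg d k α f := by
  induction k generalizing α f with
  | zero => exact h.1
  | succ k ih =>
    refine ⟨h.1, fun i => ?_⟩
    obtain ⟨u, hu, hu'⟩ := h.2 i
    exact ⟨u, hu, ih hu'⟩

theorem Reg.lin (hf : Reg d k α f) (hg : Reg d k α g) (a b : ℝ) :
    Reg d k α fun x => a * f x + b * g x := by
  induction k generalizing α f g with
  | zero =>
    exact ⟨(hf.1.smul a).add (hg.1.smul b), (hf.2.const_mul a).add (hg.2.const_mul b)⟩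
  | succ k ih =>
    refine ⟨⟨(hf.1.1.smul a).add (hg.1.1.smul b), (hf.1.2.const_mul a).add (hg.1.2.const_mul b)⟩,
      fun i => ?_⟩
    obtain ⟨u, hu, hu'⟩ := hf.2 i
    obtain ⟨v, hv, hv'⟩ := hg.2 i
    exact ⟨_, hu.lin hv a b, ih hu' hv'⟩

theorem memLp_coord_mul (j : Fin d) (h : MemLp f 2 (weightMeasure d α)) :
    MemLp (fun x => x j * f x) 2 (weightMeasure d α) := by
  refine h.of_le ((contDiff_coord j).continuous.aestronglyMeasurable.mul h.1) ?_
  refine weightMeasure_absolutelyContinuous.ae_le ?_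
  filter_upwards [ae_restrict_mem Metric.isOpen_ball.measurableSet] with x hx
  rw [norm_mul]
  have h1 : ‖x j‖ ≤ 1 := (PiLp.norm_apply_le x j).trans (by simpa using (mem_ball_zero_iff.1 hx).le)
  exact mul_le_of_le_one_left (norm_nonneg _) h1

theorem Reg.coord_mul (j : Fin d) (h : Reg d k α f) : Reg d k α fun x => x j * f x := by
  induction k generalizing α f with
  | zero => exact ⟨locallyIntegrableOn_coord_mul j h.1, memLp_coord_mul j h.2⟩
  | succ k ih =>
    refine ⟨⟨locallyIntegrableOn_coord_mul j h.1.1, memLp_coord_mul j h.1.2⟩, fun i => ?_⟩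
    obtain ⟨u, hu, hu'⟩ := h.2 i
    -- By the Leibniz rule `f` itself occurs in the derivative; it has regularity to spare, and a
    -- larger exponent only weakens the norm condition.
    exact ⟨_, hu.coord_mul, (h.pred.mono (by linarith)).lin (ih hu') _ 1⟩

theorem reg_zero : Reg d k α fun _ => 0 := by
  induction k generalizing α with
  | zero => exact ⟨locallyIntegrableOn_zero, MemLp.zero'⟩
  | succ k ih =>
    refine ⟨⟨locallyIntegrableOn_zero, MemLp.zero'⟩, fun i => ⟨_, ?_, ih⟩⟩
    rw [isWeakDeriv_single_iff]
    exact ⟨locallyIntegrableOn_zero, locallyIntegrableOn_zero, fun φ _ => by simp⟩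

theorem Reg.sum {ι : Type*} {t : Finset ι} {f : ι → EuclideanSpace ℝ (Fin d) → ℝ}
    (h : ∀ i ∈ t, Reg d k α (f i)) : Reg d k α fun x => ∑ i ∈ t, f i x := by
  classical
  induction t using Finset.induction_on with
  | empty => simpa using reg_zero
  | insert a t ha ih =>
    simp only [Finset.sum_insert ha]
    simpa using (h a (by simp)).lin (ih fun i hi => h i (by simp [hi])) 1 1

theorem Reg.isWeakDeriv_weakPartial (h : Reg d (k + 1) α f) (i : Fin d) :
    IsWeakDeriv (Pi.single i 1) f (weakPartial i f) := by
  have h' : ∃ g, IsWeakDeriv (Pi.single i 1) f g := (h.2 i).imp fun _ => And.left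
  rw [weakPartial, dif_pos h']
  exact h'.choose_spec

theorem Reg.weakPartial (h : Reg d (k + 1) α f) (i : Fin d) :
    Reg d k (α + 1) (weakPartial i f) := by
  obtain ⟨u, hu, hu'⟩ := h.2 i
  exact hu'.congr (hu.ae_eq (h.isWeakDeriv_weakPartial i))

/-! ### Weak forms of the Laplace and Laplace–Beltrami operators -/

theorem integral_mul_lapC {u w : Fin d → EuclideanSpace ℝ (Fin d) → ℝ}
    {φ : EuclideanSpace ℝ (Fin d) → ℝ} (hφ : IsTest φ)
    (hu : ∀ i, IsWeakDeriv (Pi.single i 1) f (u i))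
    (hw : ∀ i, IsWeakDeriv (Pi.single i 1) (u i) (w i)) :
    ∫ x, f x * lapC φ x = ∫ x, (∑ i, w i x) * φ x := by
  simp only [lapC, Finset.mul_sum, Finset.sum_mul]
  rw [integral_finsetSum _ fun i _ => ((hφ.partialD i).partialD i).integrable_mul (hu i).locInt_fun,
    integral_finsetSum _ fun i _ => hφ.integrable_mul (hw i).locInt_deriv]
  refine Finset.sum_congr rfl fun i _ => ?_
  rw [(hu i).integral_partialD (hφ.partialD i), (hw i).integral_partialD hφ, neg_neg]

theorem integral_mul_angC {i j : Fin d} (hij : i ≠ j) {u v : EuclideanSpace ℝ (Fin d) → ℝ}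
    {φ : EuclideanSpace ℝ (Fin d) → ℝ} (hφ : IsTest φ) (hu : IsWeakDeriv (Pi.single i 1) f u)
    (hv : IsWeakDeriv (Pi.single j 1) f v) :
    ∫ x, f x * angC i j φ x = -∫ x, (x i * v x - x j * u x) * φ x := by
  have h1 := (hv.coord_mul (j := i)).integral_partialD hφ
  have h2 := (hu.coord_mul (j := j)).integral_partialD hφ
  simp only [if_neg hij, if_neg hij.symm, zero_mul, zero_add, one_mul] at h1 h2
  have e1 : ∀ x, f x * angC i j φ x = x i * f x * partialD j φ x - x j * f x * partialD i φ x :=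
    fun x => by simp only [angC]; ring
  simp only [e1, sub_mul]
  rw [integral_sub ((hφ.partialD j).integrable_mul (locallyIntegrableOn_coord_mul i hu.locInt_fun))
    ((hφ.partialD i).integrable_mul (locallyIntegrableOn_coord_mul j hu.locInt_fun)), h1, h2,
    integral_sub (hφ.integrable_mul (locallyIntegrableOn_coord_mul i hv.locInt_deriv))
    (hφ.integrable_mul (locallyIntegrableOn_coord_mul j hu.locInt_deriv))]
  ring

theorem Reg.laplace (h : Reg d (k + 2) α f) : Reg d k (α + 2) (laplace f) := by
  refine Reg.sum fun i _ => ?_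
  have := (h.weakPartial i).weakPartial i
  rwa [add_assoc, one_add_one_eq_two] at this

theorem Reg.integral_laplace (h : Reg d (k + 2) α f) {φ : EuclideanSpace ℝ (Fin d) → ℝ}
    (hφ : IsTest φ) : ∫ x, f x * lapC φ x = ∫ x, BallApprox.laplace f x * φ x :=
  integral_mul_lapC hφ (fun i => h.isWeakDeriv_weakPartial i)
    fun i => (h.weakPartial i).isWeakDeriv_weakPartial i

theorem Reg.angularD (h : Reg d (k + 1) α f) (i j : Fin d) :
    Reg d k (α + 1) (angularD i j f) := by
  have := ((h.weakPartial j).coord_mul i).lin ((h.weakPartial i).coord_mul j) 1 (-1)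
  convert! this using 1
  funext x
  simp only [BallApprox.angularD]
  ring

theorem Reg.integral_angularD (h : Reg d (k + 1) α f) {i j : Fin d} (hij : i ≠ j)
    {φ : EuclideanSpace ℝ (Fin d) → ℝ} (hφ : IsTest φ) :
    ∫ x, f x * angC i j φ x = -∫ x, BallApprox.angularD i j f x * φ x :=
  integral_mul_angC hij hφ (h.isWeakDeriv_weakPartial i) (h.isWeakDeriv_weakPartial j)

theorem Reg.laplaceBeltrami (h : Reg d (k + 2) α f) : Reg d k (α + 2) (laplaceBeltrami f) := by
  refine Reg.sum fun z _ => ?_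
  have := (h.angularD z.1 z.2).angularD z.1 z.2
  rwa [add_assoc, one_add_one_eq_two] at this

theorem Reg.integral_laplaceBeltrami (h : Reg d (k + 2) α f)
    {φ : EuclideanSpace ℝ (Fin d) → ℝ} (hφ : IsTest φ) :
    ∫ x, f x * lbC φ x = ∫ x, BallApprox.laplaceBeltrami f x * φ x := by
  simp only [lbC, BallApprox.laplaceBeltrami, Finset.mul_sum, Finset.sum_mul]
  rw [integral_finsetSum _ fun z _ => ((hφ.angC z.1 z.2).angC z.1 z.2).integrable_mul h.locInt,
    integral_finsetSum _ fun z _ => hφ.integrable_mul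
      ((h.angularD z.1 z.2).angularD z.1 z.2).locInt]
  refine Finset.sum_congr rfl fun z hz => ?_
  have hz' : z.1 ≠ z.2 := (Finset.mem_filter.1 hz).2.ne
  rw [h.integral_angularD hz' (hφ.angC _ _), (h.angularD _ _).integral_angularD hz' hφ, neg_neg]

/-- The regularity only places `Δ_0^s f` in the space with exponent `α + 2 * s`, so its norm for `α`
may be infinite. Local integrability still provides the measurability needed in that case. -/
theorem Reg.laplaceBeltrami_iterate {s : ℕ} (h : Reg d (2 * s) α f) :
    LocallyIntegrableOn (BallApprox.laplaceBeltrami^[s] f) (Metric.ball 0 1) volume := by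
  induction s generalizing α f with
  | zero => exact h.locInt
  | succ s ih => exact ih (Reg.laplaceBeltrami h)

theorem Reg.integral_laplaceBeltrami_iterate {s : ℕ} (h : Reg d (2 * s) α f)
    {φ : EuclideanSpace ℝ (Fin d) → ℝ} (hφ : IsTest φ) :
    ∫ x, f x * lbC^[s] φ x = ∫ x, (BallApprox.laplaceBeltrami^[s] f) x * φ x := by
  induction s generalizing α f with
  | zero => rfl
  | succ s ih =>
    rw [Function.iterate_succ_apply', Function.iterate_succ_apply,
      Reg.integral_laplaceBeltrami (k := 2 * s) h (hφ.lbC_iterate s)]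
    exact ih (Reg.laplaceBeltrami h)

/-- Testing against `multiD m φ` shows that `∂^m` of the weak derivative `∂_i f` is `∂^(m + e_i) f`.
Hence the multi-index conditions become recursive, one derivative at a time. -/
theorem reg_of_weakDeriv (hf : LocallyIntegrableOn f (Metric.ball 0 1) volume)
    (hf2 : MemLp f 2 (weightMeasure d α))
    (h : ∀ m : Fin d → ℕ, ∑ i, m i ≤ k → ∃ g, IsWeakDeriv m f g ∧
      MemLp g 2 (weightMeasure d (α + ((∑ i, m i : ℕ) : ℝ)))) : Reg d k α f := by
  induction k generalizing α f with
  | zero => exact ⟨hf, hf2⟩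
  | succ k ih =>
    refine ⟨⟨hf, hf2⟩, fun i => ?_⟩
    have hs : ∑ j, (Pi.single i 1 : Fin d → ℕ) j = 1 := by rw [Finset.sum_pi_single']; simp
    obtain ⟨g, hg, hg2⟩ := h (Pi.single i 1) (by omega)
    rw [hs, Nat.cast_one] at hg2
    refine ⟨g, hg, ih hg.locInt_deriv hg2 fun m hm => ?_⟩
    have hms : ∑ j, (m + Pi.single i 1 : Fin d → ℕ) j = ∑ j, m j + 1 := by
      simp only [Pi.add_apply, Finset.sum_add_distrib, hs]
    obtain ⟨u, hu, hu2⟩ := h (m + Pi.single i 1) (by omega)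
    rw [hms] at hu2
    refine ⟨u, ⟨hg.locInt_deriv, hu.locInt_deriv, fun φ hφ => ?_⟩, ?_⟩
    · have h1 := hg.integral_partialD (hφ.multiD m)
      have h2 := hu.integral_eq φ hφ
      rw [multiD_add_single m i hφ.smooth, hms, pow_succ] at h2
      linarith
    · convert hu2 using 2
      push_cast
      ring

theorem MemW.reg (hd : 1 ≤ d) (hα : -1 < α) (h : MemW k α f) : Reg d k α f := by
  obtain ⟨g, hg, -⟩ := h.2 0 (by simp)
  refine reg_of_weakDeriv hg.locInt_fun ((memLp_ballMeasure_iff hd hα).1 h.1) fun m hm => ?_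
  obtain ⟨u, hu, hu2⟩ := h.2 m hm
  refine ⟨u, hu, (memLp_ballMeasure_iff hd ?_).1 hu2⟩
  have : (0 : ℝ) ≤ ((∑ i, m i : ℕ) : ℝ) := Nat.cast_nonneg _
  linarith

/-! ### Weak operators on polynomials agree with the formal ones -/

theorem isWeakDeriv_pev (i : Fin d) (p : MvPolynomial (Fin d) ℝ) :
    IsWeakDeriv (Pi.single i 1) (pev p) (pev (MvPolynomial.pderiv i p)) := by
  have hl : ∀ p : MvPolynomial (Fin d) ℝ,
      LocallyIntegrableOn (pev p) (Metric.ball 0 1) volume := fun p =>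
    (continuous_pev p).locallyIntegrable.locallyIntegrableOn _
  rw [isWeakDeriv_single_iff]
  refine ⟨hl _, hl _, fun φ hφ => ?_⟩
  rw [← partialD_pev]
  refine integral_mul_fderiv_eq_neg_fderiv_mul_of_integrable ?_ ?_ ?_ ?_ ?_
  · have := hφ.integrable_mul (hl (MvPolynomial.pderiv i p))
    rwa [← partialD_pev] at this
  · exact (hφ.partialD i).integrable_mul (hl p)
  · exact hφ.integrable_mul (hl p)
  · exact fun x _ => (contDiff_pev p).differentiable (by simp) x
  · exact fun x _ => hφ.smooth.differentiable (by simp) x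

theorem integral_pev_mul_lapC (p : MvPolynomial (Fin d) ℝ) {φ : EuclideanSpace ℝ (Fin d) → ℝ}
    (hφ : IsTest φ) : ∫ x, pev p x * lapC φ x = ∫ x, pev (lapP p) x * φ x := by
  rw [integral_mul_lapC hφ (fun i => isWeakDeriv_pev i p) fun i => isWeakDeriv_pev i _]
  simp [lapP_apply]

theorem integral_pev_mul_angC (p : MvPolynomial (Fin d) ℝ) {i j : Fin d} (hij : i ≠ j)
    {φ : EuclideanSpace ℝ (Fin d) → ℝ}
    (hφ : IsTest φ) : ∫ x, pev p x * angC i j φ x = -∫ x, pev (angP i j p) x * φ x := by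
  rw [integral_mul_angC hij hφ (isWeakDeriv_pev i p) (isWeakDeriv_pev j p)]
  simp [angP_apply]

theorem integral_pev_mul_lbC (p : MvPolynomial (Fin d) ℝ) {φ : EuclideanSpace ℝ (Fin d) → ℝ}
    (hφ : IsTest φ) : ∫ x, pev p x * lbC φ x = ∫ x, pev (lbP p) x * φ x := by
  have hl : ∀ p : MvPolynomial (Fin d) ℝ,
      LocallyIntegrableOn (pev p) (Metric.ball 0 1) volume := fun p =>
    (continuous_pev p).locallyIntegrable.locallyIntegrableOn _
  simp only [lbC, lbP_apply, pev_sum, Finset.mul_sum, Finset.sum_mul]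
  rw [integral_finsetSum _ fun z _ => ((hφ.angC z.1 z.2).angC z.1 z.2).integrable_mul (hl p),
    integral_finsetSum _ fun z _ => hφ.integrable_mul (hl _)]
  refine Finset.sum_congr rfl fun z hz => ?_
  have hz' : z.1 ≠ z.2 := (Finset.mem_filter.1 hz).2.ne
  rw [integral_pev_mul_angC p hz' (hφ.angC _ _), integral_pev_mul_angC _ hz' hφ, neg_neg]

end Weak

/-! ### Radial cutoffs -/

section Cutoff

open Filter Topology

/-- Smooth profiles on the line that vanish to the left of `1` and are equal to `c` to the right
of `2`. -/
structure IsProfile (c : ℝ) (h : ℝ → ℝ) : Prop where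
  smooth : ContDiff ℝ ∞ h
  left : ∀ s < 1, h s = 0
  right : ∀ s, 2 < s → h s = c

/-- The profile of the derivative of `t ^ a * h (κ * t)`. -/
noncomputable def profileD (a : ℝ) (h : ℝ → ℝ) : ℝ → ℝ := fun s => a * h s + s * deriv h s

/-- The function `t ^ a * h (κ * t)`. -/
noncomputable def cutPow (a : ℝ) (h : ℝ → ℝ) (κ : ℝ) : ℝ → ℝ := fun t => t ^ a * h (κ * t)

theorem isProfile_smoothTransition : IsProfile 1 fun s => Real.smoothTransition (s - 1) where
  smooth := Real.smoothTransition.contDiff.comp (contDiff_id.sub contDiff_const)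
  left s hs := Real.smoothTransition.zero_of_nonpos (by linarith)
  right s hs := Real.smoothTransition.one_of_one_le (by linarith)

variable {c a κ : ℝ} {h : ℝ → ℝ}

/-- Differentiating `t ^ a` multiplies the terminal constant of the profile by `a`; these constants
become the coefficients of the adjoint in the limit. -/
theorem IsProfile.profileD (hh : IsProfile c h) (a : ℝ) : IsProfile (a * c) (profileD a h) where
  smooth := (contDiff_const.mul hh.smooth).add (contDiff_id.mul
    ((contDiff_infty_iff_deriv.1 hh.smooth).2))
  left s hs := by
    have : h =ᶠ[𝓝 s] fun _ => 0 := by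
      filter_upwards [Iio_mem_nhds hs] with t ht using hh.left t ht
    simp [BallApprox.profileD, hh.left s hs, this.deriv_eq]
  right s hs := by
    have : h =ᶠ[𝓝 s] fun _ => c := by
      filter_upwards [Ioi_mem_nhds hs] with t ht using hh.right t ht
    simp [BallApprox.profileD, hh.right s hs, this.deriv_eq]

theorem IsProfile.exists_bound (hh : IsProfile c h) : ∃ C, 0 ≤ C ∧ ∀ s, |h s| ≤ C := by
  obtain ⟨C, hC⟩ := (isCompact_Icc (a := (1 : ℝ)) (b := 2)).exists_bound_of_continuousOn
    hh.smooth.continuous.continuousOn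
  refine ⟨max C |c|, (abs_nonneg c).trans (le_max_right _ _), fun s => ?_⟩
  by_cases h1 : s < 1
  · rw [hh.left s h1, abs_zero]
    exact (abs_nonneg c).trans (le_max_right _ _)
  by_cases h2 : 2 < s
  · rw [hh.right s h2]
    exact le_max_right _ _
  · exact (hC s ⟨not_lt.1 h1, not_lt.1 h2⟩).trans (le_max_left _ _)

theorem IsProfile.tendsto (hh : IsProfile c h) {t : ℝ} (ht : 0 < t) :
    Tendsto (fun n : ℕ => h (((n : ℝ) + 1) * t)) atTop (𝓝 c) := by
  refine tendsto_const_nhds.congr' ?_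
  have : Tendsto (fun n : ℕ => ((n : ℝ) + 1) * t) atTop atTop :=
    (tendsto_atTop_add_const_right _ 1 tendsto_natCast_atTop_atTop).atTop_mul_const ht
  filter_upwards [this.eventually_gt_atTop 2] with n hn
  exact (hh.right _ hn).symm

theorem cutPow_eventuallyEq_zero (hh : IsProfile c h) (hκ : 0 < κ) {t : ℝ} (ht : t ≤ 0) :
    cutPow a h κ =ᶠ[𝓝 t] fun _ => 0 := by
  have : κ * t < 1 := by nlinarith
  filter_upwards [(continuous_const_mul κ).continuousAt.eventually_lt_const this] with u hu
  simp [cutPow, hh.left _ hu]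

theorem contDiff_cutPow (hh : IsProfile c h) (hκ : 0 < κ) : ContDiff ℝ ∞ (cutPow a h κ) := by
  rw [contDiff_iff_contDiffAt]
  intro t
  rcases le_or_gt t 0 with ht | ht
  · exact contDiffAt_const.congr_of_eventuallyEq (cutPow_eventuallyEq_zero hh hκ ht)
  · exact (Real.contDiffAt_rpow_const_of_ne ht.ne').mul
      (hh.smooth.comp (contDiff_const.mul contDiff_id)).contDiffAt

/-- The factor `κ` produced by the chain rule is absorbed as `κ t * h' (κ t)`, at the cost of one
power of `t`. Derivatives thus stay in the same class, with profiles bounded independently of `κ`.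
-/
theorem deriv_cutPow (hh : IsProfile c h) (hκ : 0 < κ) :
    deriv (cutPow a h κ) = cutPow (a - 1) (profileD a h) κ := by
  funext t
  rcases le_or_gt t 0 with ht | ht
  · rw [(cutPow_eventuallyEq_zero hh hκ ht).deriv_eq,
      (cutPow_eventuallyEq_zero (hh.profileD a) hκ ht).eq_of_nhds, deriv_const]
  · have h1 := Real.hasDerivAt_rpow_const (x := t) (p := a) (Or.inl ht.ne')
    have h2 : HasDerivAt (fun t => h (κ * t)) (deriv h (κ * t) * κ) t := by
      have := (hh.smooth.differentiable (by simp) (κ * t)).hasDerivAt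
      exact this.comp t (by simpa using (hasDerivAt_id t).const_mul κ)
    have h3 := (h1.mul h2).deriv
    have e : t ^ a = t ^ (a - 1) * t := by
      rw [Real.rpow_sub_one ht.ne', div_mul_cancel₀ _ ht.ne']
    rw [show cutPow a h κ = (fun t => t ^ a) * fun t => h (κ * t) from rfl, h3]
    simp only [cutPow, profileD, e]
    ring

end Cutoff

/-! ### Polynomials times radial functions -/

section Radial

variable {d : ℕ}

theorem pev_rsq (x : EuclideanSpace ℝ (Fin d)) : pev (rsq d) x = ‖x‖ ^ 2 := by
  simp [rsq, EuclideanSpace.real_norm_sq_eq]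

theorem contDiff_radial {w : ℝ → ℝ} (hw : ContDiff ℝ ∞ w) :
    ContDiff ℝ ∞ fun x : EuclideanSpace ℝ (Fin d) => w (1 - ‖x‖ ^ 2) :=
  hw.comp (contDiff_const.sub (contDiff_norm_sq ℝ))

theorem contDiff_pev_mul_radial (q : MvPolynomial (Fin d) ℝ) {w : ℝ → ℝ}
    (hw : ContDiff ℝ ∞ w) :
    ContDiff ℝ ∞ fun x : EuclideanSpace ℝ (Fin d) => pev q x * w (1 - ‖x‖ ^ 2) :=
  (contDiff_pev q).mul (contDiff_radial hw)

theorem partialD_radial (i : Fin d) {w : ℝ → ℝ} (hw : ContDiff ℝ ∞ w) :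
    partialD i (fun x : EuclideanSpace ℝ (Fin d) => w (1 - ‖x‖ ^ 2)) =
      fun x => -2 * x i * deriv w (1 - ‖x‖ ^ 2) := by
  funext x
  have h1 : HasFDerivAt (fun x : EuclideanSpace ℝ (Fin d) => 1 - ‖x‖ ^ 2)
      (-(2 • (innerSL ℝ x))) x := by
    simpa using (hasStrictFDerivAt_norm_sq x).hasFDerivAt.const_sub 1
  have h2 := ((hw.differentiable (by simp) (1 - ‖x‖ ^ 2)).hasDerivAt.comp_hasFDerivAt x h1).fderiv
  simp only [partialD]
  rw [show (fun x : EuclideanSpace ℝ (Fin d) => w (1 - ‖x‖ ^ 2)) =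
    w ∘ fun x => 1 - ‖x‖ ^ 2 from rfl, h2]
  simp [EuclideanSpace.inner_single_right]
  ring

theorem partialD_pev_mul_radial (i : Fin d) (q : MvPolynomial (Fin d) ℝ) {w : ℝ → ℝ}
    (hw : ContDiff ℝ ∞ w) :
    partialD i (fun x : EuclideanSpace ℝ (Fin d) => pev q x * w (1 - ‖x‖ ^ 2)) =
      fun x => pev (MvPolynomial.pderiv i q) x * w (1 - ‖x‖ ^ 2) +
        pev (MvPolynomial.C (-2) * (MvPolynomial.X i * q)) x * deriv w (1 - ‖x‖ ^ 2) := by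
  rw [partialD_mul i (contDiff_pev q) (contDiff_radial hw), partialD_pev, partialD_radial i hw]
  funext x
  simp only [pev_mul, pev_C, pev_X]
  ring

theorem lapC_pev_mul_radial (q : MvPolynomial (Fin d) ℝ) {w : ℝ → ℝ} (hw : ContDiff ℝ ∞ w)
    (x : EuclideanSpace ℝ (Fin d)) :
    lapC (fun x => pev q x * w (1 - ‖x‖ ^ 2)) x = pev (lapP q) x * w (1 - ‖x‖ ^ 2)
      - (4 * pev (eulerP q) x + 2 * d * pev q x) * deriv w (1 - ‖x‖ ^ 2)
      + 4 * ‖x‖ ^ 2 * pev q x * deriv (deriv w) (1 - ‖x‖ ^ 2) := by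
  have hw1 : ContDiff ℝ ∞ (deriv w) := (contDiff_infty_iff_deriv.1 hw).2
  have key : ∀ i, partialD i (partialD i fun x => pev q x * w (1 - ‖x‖ ^ 2)) x =
      pev (MvPolynomial.pderiv i (MvPolynomial.pderiv i q)) x * w (1 - ‖x‖ ^ 2)
      + (-4 * pev (MvPolynomial.X i * MvPolynomial.pderiv i q) x - 2 * pev q x)
        * deriv w (1 - ‖x‖ ^ 2)
      + 4 * (x i) ^ 2 * pev q x * deriv (deriv w) (1 - ‖x‖ ^ 2) := by
    intro i
    rw [partialD_pev_mul_radial i q hw, partialD_add i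
      (contDiff_pev_mul_radial _ hw) (contDiff_pev_mul_radial _ hw1),
      partialD_pev_mul_radial i _ hw, partialD_pev_mul_radial i _ hw1]
    simp only [MvPolynomial.pderiv_C, pev_zero, MvPolynomial.pderiv_mul, MvPolynomial.pderiv_X_self,
      pev_mul, pev_C, pev_X, pev_add, one_mul]
    ring
  simp only [lapC, key, Finset.sum_add_distrib, ← Finset.sum_mul, ← Finset.mul_sum,
    Finset.sum_sub_distrib, Finset.sum_const, Finset.card_univ, Fintype.card_fin, nsmul_eq_mul]
  rw [lapP_apply, eulerP_apply, pev_sum, pev_sum, EuclideanSpace.real_norm_sq_eq]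
  ring

/-- Angular derivatives annihilate radial functions, so the cutoff passes through `Δ_0` unchanged.
-/
theorem angC_pev_mul_radial (i j : Fin d) (q : MvPolynomial (Fin d) ℝ) {w : ℝ → ℝ}
    (hw : ContDiff ℝ ∞ w) :
    angC i j (fun x => pev q x * w (1 - ‖x‖ ^ 2)) =
      fun x => pev (angP i j q) x * w (1 - ‖x‖ ^ 2) := by
  funext x
  simp only [angC, partialD_pev_mul_radial _ q hw, angP_apply, pev_mul, pev_C, pev_X, pev_sub]
  ring

theorem lbC_pev_mul_radial (q : MvPolynomial (Fin d) ℝ) {w : ℝ → ℝ} (hw : ContDiff ℝ ∞ w) :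
    lbC (fun x => pev q x * w (1 - ‖x‖ ^ 2)) =
      fun x => pev (lbP q) x * w (1 - ‖x‖ ^ 2) := by
  funext x
  simp only [lbC, angC_pev_mul_radial _ _ _ hw, lbP_apply, pev_sum, Finset.sum_mul]

theorem lbC_iterate_pev_mul_radial (s : ℕ) (q : MvPolynomial (Fin d) ℝ) {w : ℝ → ℝ}
    (hw : ContDiff ℝ ∞ w) :
    lbC^[s] (fun x => pev q x * w (1 - ‖x‖ ^ 2)) =
      fun x => pev (lbP^[s] q) x * w (1 - ‖x‖ ^ 2) := by
  induction s generalizing q with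
  | zero => rfl
  | succ s ih => rw [Function.iterate_succ_apply, lbC_pev_mul_radial q hw, ih,
      Function.iterate_succ_apply]

theorem isTest_pev_mul_cutPow {c a κ : ℝ} {h : ℝ → ℝ} (hh : IsProfile c h) (hκ : 0 < κ)
    (q : MvPolynomial (Fin d) ℝ) :
    IsTest fun x : EuclideanSpace ℝ (Fin d) => pev q x * cutPow a h κ (1 - ‖x‖ ^ 2) := by
  have hS : IsClosed {x : EuclideanSpace ℝ (Fin d) | 1 ≤ κ * (1 - ‖x‖ ^ 2)} :=
    isClosed_le continuous_const (by fun_prop)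
  have hsub : {x : EuclideanSpace ℝ (Fin d) | 1 ≤ κ * (1 - ‖x‖ ^ 2)} ⊆ Metric.ball 0 1 := by
    intro x hx
    rw [mem_ball_zero_iff]
    have h1 : 0 < 1 - ‖x‖ ^ 2 := by
      by_contra hneg
      have : κ * (1 - ‖x‖ ^ 2) ≤ 0 := mul_nonpos_of_nonneg_of_nonpos hκ.le (not_lt.1 hneg)
      have hx1 : 1 ≤ κ * (1 - ‖x‖ ^ 2) := hx
      linarith
    nlinarith [norm_nonneg x]
  have hsupp : tsupport (fun x : EuclideanSpace ℝ (Fin d) =>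
      pev q x * cutPow a h κ (1 - ‖x‖ ^ 2)) ⊆ {x | 1 ≤ κ * (1 - ‖x‖ ^ 2)} := by
    refine closure_minimal (fun x hx => ?_) hS
    by_contra hlt
    refine hx ?_
    simp [cutPow, hh.left _ (not_le.1 hlt)]
  exact ⟨contDiff_pev_mul_radial q (contDiff_cutPow hh hκ),
    (isCompact_closedBall 0 1).of_isClosed_subset (isClosed_tsupport _)
      (hsupp.trans (hsub.trans Metric.ball_subset_closedBall)), hsupp.trans hsub⟩

end Radial

/-! ### Integration by parts against polynomials -/

section Parts

open Filter Topology

variable {d : ℕ} {α : ℝ}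

/-- Dominated convergence: the weighted measure is finite, so `g` is integrable and `C * ‖g‖` is a
majorant. -/
theorem tendsto_integral_mul (hd : 1 ≤ d) (hα : -1 < α) {g : EuclideanSpace ℝ (Fin d) → ℝ}
    (hg : MemLp g 2 (weightMeasure d α)) {K : ℕ → EuclideanSpace ℝ (Fin d) → ℝ}
    {L : EuclideanSpace ℝ (Fin d) → ℝ} {C : ℝ} (hK : ∀ n, Continuous (K n))
    (hC : ∀ n, ∀ x ∈ Metric.ball 0 1, |K n x| ≤ C)
    (hL : ∀ x ∈ Metric.ball 0 1, Tendsto (fun n => K n x) atTop (𝓝 (L x))) :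
    Tendsto (fun n => ∫ x, g x * K n x ∂(weightMeasure d α)) atTop
      (𝓝 (∫ x, g x * L x ∂(weightMeasure d α))) := by
  have := isFiniteMeasure_weightMeasure hd hα
  have hball : ∀ᵐ x ∂(weightMeasure d α), x ∈ Metric.ball (0 : EuclideanSpace ℝ (Fin d)) 1 :=
    weightMeasure_absolutelyContinuous.ae_le (ae_restrict_mem Metric.isOpen_ball.measurableSet)
  refine tendsto_integral_of_dominated_convergence (fun x => C * ‖g x‖)
    (fun n => hg.1.mul (hK n).aestronglyMeasurable)
    ((hg.integrable (by norm_num)).norm.const_mul C) (fun n => ?_) ?_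
  · filter_upwards [hball] with x hx
    rw [norm_mul, mul_comm]
    exact mul_le_mul_of_nonneg_right (hC n x hx) (norm_nonneg _)
  · filter_upwards [hball] with x hx using (hL x hx).const_mul _

theorem exists_bound_pev (p : MvPolynomial (Fin d) ℝ) :
    ∃ C, 0 ≤ C ∧ ∀ x ∈ Metric.ball (0 : EuclideanSpace ℝ (Fin d)) 1, |pev p x| ≤ C := by
  obtain ⟨C, hC⟩ := (isCompact_closedBall (0 : EuclideanSpace ℝ (Fin d)) 1).exists_bound_of_continuousOn
    (continuous_pev p).continuousOn
  exact ⟨max C 0, le_max_right _ _, fun x hx =>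
    (hC x (Metric.ball_subset_closedBall hx)).trans (le_max_left _ _)⟩

theorem tendsto_integral_pev_mul_profile (hd : 1 ≤ d) (hα : -1 < α)
    {g : EuclideanSpace ℝ (Fin d) → ℝ} (hg : MemLp g 2 (weightMeasure d α))
    (p : MvPolynomial (Fin d) ℝ) {c : ℝ} {h : ℝ → ℝ} (hh : IsProfile c h) :
    Tendsto (fun n : ℕ => ∫ x, g x * (pev p x * h (((n : ℝ) + 1) * (1 - ‖x‖ ^ 2)))
      ∂(weightMeasure d α)) atTop (𝓝 (∫ x, g x * (pev p x * c) ∂(weightMeasure d α))) := by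
  obtain ⟨C, hC0, hC⟩ := exists_bound_pev p
  obtain ⟨H, hH0, hH⟩ := hh.exists_bound
  refine tendsto_integral_mul hd hα hg (C := C * H) (fun n => ?_) (fun n x hx => ?_)
    fun x hx => (hh.tendsto (one_sub_norm_sq_pos hx)).const_mul _
  · exact (continuous_pev p).mul (hh.smooth.continuous.comp (by fun_prop))
  · rw [abs_mul]
    exact mul_le_mul (hC x hx) (hH _) (abs_nonneg _) hC0

theorem integral_eq_setIntegral_ball {u φ : EuclideanSpace ℝ (Fin d) → ℝ} (hφ : IsTest φ) :
    ∫ x, u x * φ x = ∫ x in Metric.ball 0 1, u x * φ x :=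
  (setIntegral_eq_integral_of_forall_compl_eq_zero fun x hx => by simp [hφ.eq_zero hx]).symm

theorem integral_mul_pev_mul_cutPow {c a κ : ℝ} {h : ℝ → ℝ} (hh : IsProfile c h) (hκ : 0 < κ)
    (u : EuclideanSpace ℝ (Fin d) → ℝ) (q : MvPolynomial (Fin d) ℝ) :
    ∫ x, u x * (pev q x * cutPow a h κ (1 - ‖x‖ ^ 2)) =
      ∫ x, u x * (pev q x * h (κ * (1 - ‖x‖ ^ 2))) ∂(weightMeasure d a) := by
  rw [integral_eq_setIntegral_ball (isTest_pev_mul_cutPow hh hκ q), integral_weightMeasure]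
  refine integral_congr_ae (ae_of_all _ fun x => ?_)
  simp only [cutPow]
  ring

/-- Integration by parts for the Laplace operator against a polynomial and the weight. -/
theorem integral_mul_pev_eq_integral_mul_adjP (hd : 1 ≤ d) (hα : -1 < α)
    {g u : EuclideanSpace ℝ (Fin d) → ℝ} (hg : MemLp g 2 (weightMeasure d α))
    (hu : MemLp u 2 (weightMeasure d (α + 2)))
    (H : ∀ φ, IsTest φ → ∫ x, g x * lapC φ x = ∫ x, u x * φ x) (q : MvPolynomial (Fin d) ℝ) :
    ∫ x, u x * pev q x ∂(weightMeasure d (α + 2)) =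
      ∫ x, g x * pev (adjP (α + 2) q) x ∂(weightMeasure d α) := by
  have h0 := isProfile_smoothTransition
  set h : ℝ → ℝ := fun s => Real.smoothTransition (s - 1)
  have h1 := h0.profileD (α + 2)
  set h' := profileD (α + 2) h
  have h2 := h1.profileD (α + 2 - 1)
  set h'' := profileD (α + 2 - 1) h'
  have t1 := tendsto_integral_pev_mul_profile hd (by linarith) hu q h0
  simp only [mul_one] at t1
  -- This is the Laplacian of the cut-off weighted polynomial divided by the weight `(1 - ‖x‖²)^α`.
  -- Each derivative of the radial factor costs one of the two extra powers of `1 - ‖x‖²`, so no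
  -- negative power remains.
  set G : ℕ → EuclideanSpace ℝ (Fin d) → ℝ := fun n x =>
    pev ((1 - rsq d) ^ 2 * lapP q) x * h (((n : ℝ) + 1) * (1 - ‖x‖ ^ 2))
    + pev ((1 - rsq d) * (-((4 : ℝ) • eulerP q) - (2 * d : ℝ) • q)) x
      * h' (((n : ℝ) + 1) * (1 - ‖x‖ ^ 2))
    + pev ((4 : ℝ) • (rsq d * q)) x * h'' (((n : ℝ) + 1) * (1 - ‖x‖ ^ 2)) with hG
  have e : ∀ n : ℕ, ∫ x, u x * (pev q x * h (((n : ℝ) + 1) * (1 - ‖x‖ ^ 2)))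
      ∂(weightMeasure d (α + 2)) = ∫ x, g x * G n x ∂(weightMeasure d α) := by
    intro n
    have hn : (0 : ℝ) < (n : ℝ) + 1 := by positivity
    have hφ := isTest_pev_mul_cutPow (a := α + 2) h0 hn q
    rw [← integral_mul_pev_mul_cutPow h0 hn, ← H _ hφ, integral_eq_setIntegral_ball hφ.lapC,
      integral_weightMeasure]
    refine setIntegral_congr_fun Metric.isOpen_ball.measurableSet fun x hx => ?_
    have hρ := one_sub_norm_sq_pos hx
    rw [lapC_pev_mul_radial q (contDiff_cutPow h0 hn), deriv_cutPow h0 hn, deriv_cutPow h1 hn]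
    have e1 : (1 - ‖x‖ ^ 2) ^ (α + 2) = (1 - ‖x‖ ^ 2) ^ α * (1 - ‖x‖ ^ 2) ^ 2 := by
      rw [Real.rpow_add hρ, Real.rpow_two]
    have e2 : (1 - ‖x‖ ^ 2) ^ (α + 2 - 1) = (1 - ‖x‖ ^ 2) ^ α * (1 - ‖x‖ ^ 2) := by
      rw [show α + 2 - 1 = α + 1 by ring, Real.rpow_add hρ, Real.rpow_one]
    have e3 : (1 - ‖x‖ ^ 2) ^ (α + 2 - 1 - 1) = (1 - ‖x‖ ^ 2) ^ α := by
      rw [show α + 2 - 1 - 1 = α by ring]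
    change _ * (_ - _ * cutPow (α + 2 - 1) h' _ _ + _ * cutPow (α + 2 - 1 - 1) h'' _ _) = _
    simp only [hG, cutPow, e1, e2, e3, pev_mul, pev_pow, pev_one, pev_sub, pev_neg, pev_smul,
      pev_rsq]
    ring
  have t2 : Tendsto (fun n => ∫ x, g x * G n x ∂(weightMeasure d α)) atTop
      (𝓝 (∫ x, g x * pev (adjP (α + 2) q) x ∂(weightMeasure d α))) := by
    obtain ⟨A0, hA0, hA0'⟩ := exists_bound_pev ((1 - rsq d) ^ 2 * lapP q)
    obtain ⟨A1, hA1, hA1'⟩ := exists_bound_pev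
      ((1 - rsq d) * (-((4 : ℝ) • eulerP q) - (2 * d : ℝ) • q))
    obtain ⟨A2, hA2, hA2'⟩ := exists_bound_pev ((4 : ℝ) • (rsq d * q))
    obtain ⟨B0, hB0, hB0'⟩ := h0.exists_bound
    obtain ⟨B1, hB1, hB1'⟩ := h1.exists_bound
    obtain ⟨B2, hB2, hB2'⟩ := h2.exists_bound
    refine tendsto_integral_mul hd hα hg (C := A0 * B0 + A1 * B1 + A2 * B2) (fun n => ?_)
      (fun n x hx => ?_) fun x hx => ?_
    · exact (((continuous_pev _).mul (h0.smooth.continuous.comp (by fun_prop))).add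
        ((continuous_pev _).mul (h1.smooth.continuous.comp (by fun_prop)))).add
        ((continuous_pev _).mul (h2.smooth.continuous.comp (by fun_prop)))
    · refine (abs_add_le _ _).trans (add_le_add ((abs_add_le _ _).trans (add_le_add ?_ ?_)) ?_)
      · rw [abs_mul]; exact mul_le_mul (hA0' x hx) (hB0' _) (abs_nonneg _) hA0
      · rw [abs_mul]; exact mul_le_mul (hA1' x hx) (hB1' _) (abs_nonneg _) hA1
      · rw [abs_mul]; exact mul_le_mul (hA2' x hx) (hB2' _) (abs_nonneg _) hA2
    · have hρ := one_sub_norm_sq_pos hx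
      have := (((h0.tendsto hρ).const_mul (pev ((1 - rsq d) ^ 2 * lapP q) x)).add
        ((h1.tendsto hρ).const_mul
          (pev ((1 - rsq d) * (-((4 : ℝ) • eulerP q) - (2 * d : ℝ) • q)) x))).add
        ((h2.tendsto hρ).const_mul (pev ((4 : ℝ) • (rsq d * q)) x))
      -- The three profiles tend to `1`, `α + 2` and `(α + 2) (α + 1)`, which reproduces the
      -- coefficients of `adjP (α + 2)`.
      convert this using 2
      rw [adjP_apply]
      simp only [pev_add, pev_sub, pev_mul, pev_smul, pev_neg]
      ring
  exact tendsto_nhds_unique (t1.congr e) t2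

/-- Integration by parts for powers of the Laplace-Beltrami operator against a polynomial. -/
theorem integral_mul_pev_eq_integral_mul_lbP (hd : 1 ≤ d) (hα : -1 < α)
    {g u : EuclideanSpace ℝ (Fin d) → ℝ} (hg : MemLp g 2 (weightMeasure d α))
    (hu : MemLp u 2 (weightMeasure d α)) (s : ℕ)
    (H : ∀ φ, IsTest φ → ∫ x, g x * lbC^[s] φ x = ∫ x, u x * φ x) (q : MvPolynomial (Fin d) ℝ) :
    ∫ x, u x * pev q x ∂(weightMeasure d α) =
      ∫ x, g x * pev (lbP^[s] q) x ∂(weightMeasure d α) := by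
  have h0 := isProfile_smoothTransition
  have t1 := tendsto_integral_pev_mul_profile hd hα hu q h0
  have t2 := tendsto_integral_pev_mul_profile hd hα hg (lbP^[s] q) h0
  simp only [mul_one] at t1 t2
  refine tendsto_nhds_unique (t1.congr fun n => ?_) t2
  have hn : (0 : ℝ) < (n : ℝ) + 1 := by positivity
  rw [← integral_mul_pev_mul_cutPow h0 hn, ← H _ (isTest_pev_mul_cutPow h0 hn q),
    ← integral_mul_pev_mul_cutPow h0 hn, lbC_iterate_pev_mul_radial s q (contDiff_cutPow h0 hn)]

end Parts

/-! ### Orthogonal decompositions in inner product spaces -/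

section Abstract

open Module

/-- A symmetric `T` preserving `P m` and `P (m + 1)` preserves the orthogonal complement of `P m` in
`P (m + 1)`. The finite-dimensional spectral theorem gives an eigenbasis of each such layer, and
distinct layers are orthogonal. -/
theorem exists_orthonormal_eigenvectors {X : Type*} [NormedAddCommGroup X]
    [InnerProductSpace ℝ X] (P : ℕ → Submodule ℝ X) (hP0 : P 0 = ⊥)
    (hfin : ∀ n, FiniteDimensional ℝ (P n)) (hmono : Monotone P) (T : X →ₗ[ℝ] X)
    (hT : T.IsSymmetric) (hTP : ∀ n, ∀ x ∈ P n, T x ∈ P n) :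
    ∃ (k : ℕ → ℕ) (e : (z : Σ m, Fin (k m)) → X) (c : (Σ m, Fin (k m)) → ℝ),
      Orthonormal ℝ e ∧ (∀ z, e z ∈ P (z.1 + 1)) ∧ (∀ z, ∀ y ∈ P z.1, inner ℝ (e z) y = 0) ∧
      (∀ z, T (e z) = c z • e z) ∧ ∀ n, P n ≤ Submodule.span ℝ (Set.range e) := by
  let V : ℕ → Submodule ℝ X := fun m => (P m)ᗮ ⊓ P (m + 1)
  have hVfin : ∀ m, FiniteDimensional ℝ (V m) := fun m =>
    Submodule.finiteDimensional_of_le inf_le_right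
  have hTV : ∀ m, ∀ x ∈ V m, T x ∈ V m := fun m x hx =>
    ⟨fun y hy => by rw [← hT y x]; exact hx.1 _ (hTP m y hy), hTP _ x hx.2⟩
  have hS : ∀ m, (T.restrict (hTV m)).IsSymmetric := fun m => hT.restrict_invariant (hTV m)
  let b := fun m => (hS m).eigenvectorBasis rfl
  have hbV : ∀ z : Σ m, Fin (finrank ℝ (V m)), ((b z.1 z.2 : V z.1) : X) ∈ V z.1 :=
    fun z => (b z.1 z.2).2
  refine ⟨fun m => finrank ℝ (V m), fun z => (b z.1 z.2 : V z.1),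
    fun z => (hS z.1).eigenvalues rfl z.2, ⟨fun z => ?_, ?_⟩, fun z => (hbV z).2,
    fun z y hy => (P z.1).inner_left_of_mem_orthogonal hy (hbV z).1, fun z => ?_, fun n => ?_⟩
  · exact (b z.1).orthonormal.1 z.2
  · rintro ⟨m, i⟩ ⟨m', i'⟩ hne
    rcases lt_trichotomy m m' with h | h | h
    · exact (P m').inner_right_of_mem_orthogonal (hmono (Nat.succ_le_of_lt h) (hbV ⟨m, i⟩).2)
        (hbV ⟨m', i'⟩).1
    · subst h
      have hii : i ≠ i' := fun h => hne (by rw [h])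
      exact (b m).orthonormal.2 hii
    · exact (P m).inner_left_of_mem_orthogonal (hmono (Nat.succ_le_of_lt h) (hbV ⟨m', i'⟩).2)
        (hbV ⟨m, i⟩).1
  · have := (hS z.1).apply_eigenvectorBasis rfl z.2
    exact congrArg Subtype.val this
  · induction n with
    | zero => rw [hP0]; exact bot_le
    | succ n ih =>
      have := hfin n
      rw [← Submodule.sup_orthogonal_inf_of_hasOrthogonalProjection (hmono n.le_succ)]
      refine sup_le ih fun x hx => ?_
      have h1 := (b n).sum_repr ⟨x, hx⟩
      have h2 := congrArg Subtype.val h1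
      simp only [Submodule.coe_sum, Submodule.coe_smul] at h2
      rw [← h2]
      exact Submodule.sum_mem _ fun i _ => Submodule.smul_mem _ _
        (Submodule.subset_span ⟨⟨n, i⟩, rfl⟩)

/-- The operator is defined on polynomials only, so the inner product is pulled back along `J`
instead of extending `T` to `H`. -/
theorem exists_orthonormal_eigenvectors_of_injective {V H : Type*} [AddCommGroup V] [Module ℝ V]
    [NormedAddCommGroup H] [InnerProductSpace ℝ H] (J : V →ₗ[ℝ] H) (hJ : Function.Injective J)
    (P : ℕ → Submodule ℝ V) (hP0 : P 0 = ⊥)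
    (hfin : ∀ n, FiniteDimensional ℝ (P n)) (hmono : Monotone P) (T : V →ₗ[ℝ] V)
    (hT : ∀ x y, inner ℝ (J (T x)) (J y) = inner ℝ (J x) (J (T y)))
    (hTP : ∀ n, ∀ x ∈ P n, T x ∈ P n) :
    ∃ (k : ℕ → ℕ) (e : (z : Σ m, Fin (k m)) → V) (c : (Σ m, Fin (k m)) → ℝ),
      Orthonormal ℝ (fun z => J (e z)) ∧ (∀ z, e z ∈ P (z.1 + 1)) ∧
      (∀ z, ∀ y ∈ P z.1, inner ℝ (J (e z)) (J y) = 0) ∧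
      (∀ z, T (e z) = c z • e z) ∧ ∀ n, P n ≤ Submodule.span ℝ (Set.range e) := by
  let _ : NormedAddCommGroup V := NormedAddCommGroup.induced V H J hJ
  let _ : InnerProductSpace ℝ V :=
    { NormedSpace.induced ℝ V H J with
      inner := fun x y => inner ℝ (J x) (J y)
      norm_sq_eq_re_inner := fun x => norm_sq_eq_re_inner (𝕜 := ℝ) (J x)
      conj_inner_symm := fun x y => inner_conj_symm (J x) (J y)
      add_left := fun x y z => by rw [map_add, inner_add_left]
      smul_left := fun x y r => by rw [map_smul, inner_smul_left] }
  obtain ⟨k, e, c, h1, h2⟩ := exists_orthonormal_eigenvectors P hP0 hfin hmono T hT hTP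
  exact ⟨k, e, c, ⟨fun z => h1.1 z, fun z z' h => h1.2 h⟩, h2⟩

/-- Bessel's inequality for orthogonal vectors of squared norm `τ`, after normalization. -/
theorem sum_inner_sq_div_le {ι H : Type*} [NormedAddCommGroup H] [InnerProductSpace ℝ H]
    [DecidableEq ι] (t : Finset ι) (w : ι → H) (τ : ι → ℝ) (hτ : ∀ z ∈ t, 0 < τ z)
    (hw : ∀ z ∈ t, ∀ z' ∈ t, inner ℝ (w z) (w z') = if z = z' then τ z else 0) (x : H) :
    ∑ z ∈ t, inner ℝ (w z) x ^ 2 / τ z ≤ ‖x‖ ^ 2 := by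
  have ho : Orthonormal ℝ fun z : t => (√(τ z))⁻¹ • w z := by
    rw [orthonormal_iff_ite]
    intro z z'
    rw [inner_smul_left, inner_smul_right, hw z z.2 z' z'.2]
    by_cases h : z = z'
    · subst h
      have h0 := hτ z z.2
      have h1 : √(τ z) ≠ 0 := (Real.sqrt_pos.2 h0).ne'
      simp only [if_true, conj_trivial]
      rw [← mul_assoc, ← mul_inv, Real.mul_self_sqrt h0.le, inv_mul_cancel₀ h0.ne']
    · have h' : (z : ι) ≠ z' := fun h'' => h (Subtype.ext h'')
      simp [h, h']
  have h := ho.sum_inner_products_le x (s := Finset.univ)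
  rw [← Finset.sum_coe_sort t]
  refine le_trans (le_of_eq (Finset.sum_congr rfl fun z _ => ?_)) h
  rw [inner_smul_left, Real.norm_eq_abs, sq_abs, mul_pow, conj_trivial, inv_pow,
    Real.sq_sqrt (hτ z z.2).le]
  ring

end Abstract

/-! ### Polynomials in the weighted spaces -/

section PolySpace

variable {d : ℕ} {α : ℝ}

theorem integral_lapP_mul (hd : 1 ≤ d) (hα : -1 < α) (p q : MvPolynomial (Fin d) ℝ) :
    ∫ x, pev (lapP p) x * pev q x ∂(weightMeasure d (α + 2)) =
      ∫ x, pev p x * pev (adjP (α + 2) q) x ∂(weightMeasure d α) :=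
  integral_mul_pev_eq_integral_mul_adjP hd hα (memLp_pev hd hα p)
    (memLp_pev hd (by linarith) _) (fun _ hφ => integral_pev_mul_lapC p hφ) q

theorem integral_lbP_mul (hd : 1 ≤ d) (hα : -1 < α) (p q : MvPolynomial (Fin d) ℝ) :
    ∫ x, pev (lbP p) x * pev q x ∂(weightMeasure d α) =
      ∫ x, pev p x * pev (lbP q) x ∂(weightMeasure d α) :=
  integral_mul_pev_eq_integral_mul_lbP hd hα (memLp_pev hd hα p) (memLp_pev hd hα _) 1
    (fun _ hφ => integral_pev_mul_lbC p hφ) q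

theorem integrable_mul_pev (hd : 1 ≤ d) (hα : -1 < α) {f : EuclideanSpace ℝ (Fin d) → ℝ}
    (hf : MemLp f 2 (weightMeasure d α)) (q : MvPolynomial (Fin d) ℝ) :
    Integrable (fun x => f x * pev q x) (weightMeasure d α) :=
  hf.integrable_mul (q := 2) (memLp_pev hd hα q)

theorem eq_zero_of_integral_sq_eq_zero (hd : 1 ≤ d) (hα : -1 < α) {p : MvPolynomial (Fin d) ℝ}
    (h : ∫ x, pev p x * pev p x ∂(weightMeasure d α) = 0) : p = 0 := by
  rw [integral_eq_zero_iff_of_nonneg (fun x => mul_self_nonneg _)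
    (integrable_mul_pev hd hα (memLp_pev hd hα p) p)] at h
  refine eq_zero_of_pev_ae_eq_zero (α := α) hd ?_
  filter_upwards [h] with x hx
  exact mul_self_eq_zero.1 hx

/-- The polynomials of degree at most `m` orthogonal to those of smaller degree. -/
structure IsOrthPoly (α : ℝ) (m : ℕ) (p : MvPolynomial (Fin d) ℝ) : Prop where
  mem : p ∈ degLT d (m + 1)
  orth : ∀ q ∈ degLT d m, ∫ x, pev p x * pev q x ∂(weightMeasure d α) = 0

/-- The adjoint raises degrees by at most two, so it maps polynomials of degree below `M` to
polynomials of degree below `M + 2`, which are orthogonal to `p`. -/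
theorem IsOrthPoly.lapP {M : ℕ} (hd : 1 ≤ d) (hα : -1 < α) {p : MvPolynomial (Fin d) ℝ}
    (hp : IsOrthPoly α (M + 2) p) : IsOrthPoly (α + 2) M (lapP p) where
  mem := lapP_mem_degLT hp.mem
  orth q hq := by
    rw [integral_lapP_mul hd hα]
    exact hp.orth _ (adjP_mem_degLT _ hq)

/-- The remainder `r = Δ*Δ p - λ p` has lower degree, hence is orthogonal to `p`. By symmetry `⟨r,
Δ*Δ p⟩ = ⟨Δ*Δ r, p⟩`, which vanishes since `Δ*Δ r` also has lower degree. So `⟨r, r⟩ = 0`. -/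
theorem IsOrthPoly.adjP_lapP {M : ℕ} (hd : 1 ≤ d) (hα : -1 < α) {c : ℝ}
    {p : MvPolynomial (Fin d) ℝ} (hp : IsOrthPoly α (M + 2) p) (hc : lbP p = -c • p) :
    adjP (α + 2) (BallApprox.lapP p) = lapFactor d α (M + 2) c • p := by
  have hr := adjP_lapP_sub_mem_degLT α c hp.mem hc
  set r := adjP (α + 2) (BallApprox.lapP p) - lapFactor d α (M + 2) c • p with hr_def
  refine sub_eq_zero.1 (eq_zero_of_integral_sq_eq_zero (α := α) hd hα (p := r) ?_)
  have h1 : ∫ x, pev r x * pev (adjP (α + 2) (BallApprox.lapP p)) x ∂(weightMeasure d α) = 0 := by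
    rw [← integral_lapP_mul hd hα]
    simp only [mul_comm (pev (BallApprox.lapP r) _)]
    rw [integral_lapP_mul hd hα]
    exact hp.orth _ (adjP_mem_degLT _ (lapP_mem_degLT hr))
  have h2 := hp.orth r hr
  have e : ∀ x, pev r x * pev r x = pev r x * pev (adjP (α + 2) (BallApprox.lapP p)) x
      - lapFactor d α (M + 2) c * (pev p x * pev r x) := fun x => by
    nth_rewrite 2 [hr_def]
    rw [pev_sub, pev_smul]
    ring
  simp only [e]
  rw [integral_sub (integrable_mul_pev hd hα (memLp_pev hd hα r) _)
    ((integrable_mul_pev hd hα (memLp_pev hd hα p) _).const_mul _), integral_const_mul, h1, h2]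
  ring

theorem lbP_lapP_of_eigenvector {c : ℝ} {p : MvPolynomial (Fin d) ℝ} (hc : lbP p = -c • p) :
    lbP (lapP p) = -c • lapP p := by
  rw [← lapP_lbP, hc, map_smul]

theorem lbP_iterate_of_eigenvector {c : ℝ} {p : MvPolynomial (Fin d) ℝ} (hc : lbP p = -c • p) (s : ℕ) :
    lbP^[s] p = (-c) ^ s • p := by
  induction s with
  | zero => simp
  | succ s ih => rw [Function.iterate_succ_apply', ih, map_smul, hc, smul_smul, pow_succ]

/-- The factor by which the `s`-th power of the Laplace operator, composed with its adjoint, acts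
on the orthogonal polynomials of degree `m` that are eigenvectors of the Laplace-Beltrami operator
for the eigenvalue `-c`. -/
noncomputable def lapPowFactor (d : ℕ) : ℕ → ℝ → ℕ → ℝ → ℝ
  | 0, _, _, _ => 1
  | s + 1, α, m, c => lapFactor d α m c * lapPowFactor d s (α + 2) (m - 2) c

/-- Each step moves one Laplacian from `F` to the polynomial and applies the eigenvalue equation.
The chain `F` of successive weak Laplacians is left general because it is used both for the iterates
of `f` and for those of another basis polynomial. -/
theorem integral_laplace_pow (hd : 1 ≤ d) (hα : -1 < α) (s m : ℕ) (hm : 2 * s ≤ m) {c : ℝ}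
    {p : MvPolynomial (Fin d) ℝ} (hp : IsOrthPoly α m p) (hc : lbP p = -c • p)
    (F : ℕ → EuclideanSpace ℝ (Fin d) → ℝ)
    (hF : ∀ i ≤ s, MemLp (F i) 2 (weightMeasure d (α + 2 * i)))
    (H : ∀ i < s, ∀ φ, IsTest φ → ∫ x, F i x * lapC φ x = ∫ x, F (i + 1) x * φ x) :
    ∫ x, F s x * pev (lapP^[s] p) x ∂(weightMeasure d (α + 2 * s)) =
      lapPowFactor d s α m c * ∫ x, F 0 x * pev p x ∂(weightMeasure d α) := by
  induction s generalizing α m p F with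
  | zero => simp [lapPowFactor]
  | succ s ih =>
    obtain ⟨M, rfl⟩ : ∃ M, m = M + 2 := ⟨m - 2, by omega⟩
    have h1 := ih (α := α + 2) (by linarith) M (by omega) (hp.lapP hd hα) (lbP_lapP_of_eigenvector hc)
      (fun i => F (i + 1)) (fun i hi => by
        have := hF (i + 1) (by omega)
        push_cast at this
        rwa [show α + 2 + 2 * (i : ℝ) = α + 2 * (i + 1) by ring])
      (fun i hi => H (i + 1) (by omega))
    have hF1 := hF 1 (by omega)
    rw [Nat.cast_one, mul_one] at hF1
    have hF0 := hF 0 (by omega)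
    rw [Nat.cast_zero, mul_zero, add_zero] at hF0
    have h2 := integral_mul_pev_eq_integral_mul_adjP hd hα hF0 hF1 (H 0 (by omega)) (lapP p)
    rw [hp.adjP_lapP hd hα hc] at h2
    rw [Function.iterate_succ_apply, Nat.cast_succ,
      show α + 2 * ((s : ℝ) + 1) = α + 2 + 2 * s by ring, h1, lapPowFactor, Nat.add_sub_cancel]
    simp only [zero_add]
    rw [h2]
    simp only [pev_smul, mul_left_comm _ (lapFactor d α (M + 2) c)]
    rw [integral_const_mul]
    ring

/-! ### Lower bounds for the factors of the Laplacian -/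

/-- Since `d ≥ 1` and `α > -1`, both factors are at least `m (m - 1) - c`, a bound independent of
`d` and `α`. -/
theorem lapFactor_ge (hd : 1 ≤ d) (hα : -1 < α) {m : ℕ} (hm : 1 ≤ m) {c D : ℝ} (hD : 0 ≤ D)
    (h : D ≤ (m : ℝ) * (m - 1) - c) : D ^ 2 ≤ lapFactor d α m c := by
  have hd' : (1 : ℝ) ≤ d := by exact_mod_cast hd
  have hm' : (1 : ℝ) ≤ m := by exact_mod_cast hm
  rw [lapFactor, pow_two]
  refine mul_le_mul ?_ ?_ hD ?_
  · nlinarith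
  · have : (m : ℝ) * (m - 1) ≤ (m + 2 * α + 2) * (m + 2 * α + d) :=
      mul_le_mul (by linarith) (by linarith) (by linarith) (by linarith)
    linarith
  · nlinarith

theorem lapPowFactor_ge (hd : 1 ≤ d) (hα : -1 < α) (s m : ℕ) (hm : 2 * s ≤ m) {c D : ℝ}
    (hD : 0 ≤ D)
    (h : ∀ i < s, D ≤ ((m - 2 * i : ℕ) : ℝ) * (((m - 2 * i : ℕ) : ℝ) - 1) - c) :
    D ^ (2 * s) ≤ lapPowFactor d s α m c := by
  induction s generalizing α m with
  | zero => simp [lapPowFactor]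
  | succ s ih =>
    rw [lapPowFactor, show 2 * (s + 1) = 2 + 2 * s by ring, pow_add]
    have h0 := lapFactor_ge hd hα (m := m) (c := c) (by omega) hD (by simpa using h 0 (by omega))
    refine mul_le_mul h0 (ih (by linarith) (m - 2) (by omega) fun i hi => ?_) (by positivity)
      ((by positivity : (0 : ℝ) ≤ D ^ 2).trans h0)
    have := h (i + 1) (by omega)
    rwa [show m - 2 * (i + 1) = m - 2 - 2 * i by omega] at this

/-- At stage `i < s` the degree is `M = m - 2 * i ≥ 3`, so `M (M - 1) ≥ 2 M² / 3`. Moreover `m ≤ (2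
s + 1) M`, so the constant is chosen to make `δ m² ≤ M² / 3`. Subtracting `c < δ m²` still leaves at
least `M² / 3 ≥ δ m²`. -/
theorem pow_le_lapPowFactor (hd : 1 ≤ d) (hα : -1 < α) {s m : ℕ} (hm : 2 * s < m) {c : ℝ}
    (hc : c < 1 / (3 * (2 * s + 1) ^ 2) * (m : ℝ) ^ 2) :
    (1 / (3 * (2 * s + 1) ^ 2) * (m : ℝ) ^ 2) ^ (2 * s) ≤ lapPowFactor d s α m c := by
  refine lapPowFactor_ge hd hα s m hm.le (by positivity) fun i hi => ?_
  obtain ⟨M, hM⟩ : ∃ M, M = m - 2 * i := ⟨_, rfl⟩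
  rw [← hM]
  have hM3 : (3 : ℝ) ≤ M := by exact_mod_cast (by omega : 3 ≤ M)
  have h1 : m ≤ (2 * s + 1) * M := by
    have hm' : m = M + 2 * i := by omega
    have : 2 * i ≤ 2 * s * M := by nlinarith [(by omega : 3 ≤ M)]
    nlinarith
  have h2 : (m : ℝ) ≤ (2 * s + 1) * M := by exact_mod_cast h1
  have h3 : 1 / (3 * (2 * (s : ℝ) + 1) ^ 2) * (m : ℝ) ^ 2 ≤ (M : ℝ) ^ 2 / 3 := by
    rw [div_mul_eq_mul_div, one_mul, div_le_div_iff₀ (by positivity) (by norm_num)]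
    nlinarith [pow_le_pow_left₀ (Nat.cast_nonneg m) h2 2]
  nlinarith

/-- The embedding of polynomials in the weighted space. -/
noncomputable def toL2 (hd : 1 ≤ d) (hα : -1 < α) :
    MvPolynomial (Fin d) ℝ →ₗ[ℝ] Lp ℝ 2 (weightMeasure d α) where
  toFun p := (memLp_pev hd hα p).toLp (pev p)
  map_add' p q := by
    rw [← MemLp.toLp_add (memLp_pev hd hα p) (memLp_pev hd hα q)]
    exact MemLp.toLp_congr _ _ (ae_of_all _ fun x => pev_add p q x)
  map_smul' r p := by
    rw [RingHom.id_apply, ← MemLp.toLp_const_smul r (memLp_pev hd hα p)]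
    exact MemLp.toLp_congr _ _ (ae_of_all _ fun x => pev_smul r p x)

theorem inner_toLp {f g : EuclideanSpace ℝ (Fin d) → ℝ} (hf : MemLp f 2 (weightMeasure d α))
    (hg : MemLp g 2 (weightMeasure d α)) :
    inner ℝ (hf.toLp f) (hg.toLp g) = ∫ x, g x * f x ∂(weightMeasure d α) := by
  rw [L2.inner_def]
  refine integral_congr_ae ?_
  filter_upwards [hf.coeFn_toLp, hg.coeFn_toLp] with x h1 h2
  rw [h1, h2]
  rfl

theorem inner_toL2_toLp (hd : 1 ≤ d) (hα : -1 < α) (p : MvPolynomial (Fin d) ℝ)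
    {g : EuclideanSpace ℝ (Fin d) → ℝ} (hg : MemLp g 2 (weightMeasure d α)) :
    inner ℝ (toL2 hd hα p) (hg.toLp g) = ∫ x, g x * pev p x ∂(weightMeasure d α) :=
  inner_toLp (memLp_pev hd hα p) hg

theorem inner_toL2 (hd : 1 ≤ d) (hα : -1 < α) (p q : MvPolynomial (Fin d) ℝ) :
    inner ℝ (toL2 hd hα p) (toL2 hd hα q) = ∫ x, pev q x * pev p x ∂(weightMeasure d α) :=
  inner_toLp (memLp_pev hd hα p) (memLp_pev hd hα q)

theorem toL2_injective (hd : 1 ≤ d) (hα : -1 < α) :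
    Function.Injective (toL2 (d := d) hd hα) := by
  rw [← LinearMap.ker_eq_bot, LinearMap.ker_eq_bot']
  intro p hp
  refine eq_zero_of_integral_sq_eq_zero hd hα ?_
  rw [← inner_toL2 hd hα, hp, inner_zero_left]

theorem exists_orthPoly_basis (hd : 1 ≤ d) (hα : -1 < α) :
    ∃ (k : ℕ → ℕ) (e : (z : Σ m, Fin (k m)) → MvPolynomial (Fin d) ℝ)
      (c : (Σ m, Fin (k m)) → ℝ), Orthonormal ℝ (fun z => toL2 hd hα (e z)) ∧
      (∀ z, IsOrthPoly α z.1 (e z)) ∧ (∀ z, lbP (e z) = -c z • e z) ∧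
      Submodule.span ℝ (Set.range e) = ⊤ := by
  obtain ⟨k, e, c, h1, h2, h3, h4, h5⟩ := exists_orthonormal_eigenvectors_of_injective
    (toL2 hd hα) (toL2_injective hd hα) (degLT d) degLT_zero (fun n => inferInstance)
    (fun m n h => degLT_mono h) lbP
    (fun p q => by
      rw [inner_toL2, inner_toL2, integral_lbP_mul hd hα])
    (fun n p hp => lbP_mem_degLT hp)
  -- The sign is changed so that `c` denotes an eigenvalue of `-Δ_0`.
  refine ⟨k, e, fun z => -c z, h1, fun z => ⟨h2 z, fun q hq => ?_⟩, fun z => ?_, ?_⟩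
  · rw [← inner_toL2 hd hα, real_inner_comm]
    exact h3 z q hq
  · rw [h4, neg_neg]
  · rw [eq_top_iff]
    intro p _
    obtain ⟨m, hm⟩ := exists_mem_degLT p
    exact h5 _ hm

end PolySpace

/-! ### Density of polynomials -/

section Density

variable {d : ℕ} {α : ℝ}

/-- Stone–Weierstrass on the closed ball: the coordinate functions separate points. -/
theorem exists_pev_near (g : EuclideanSpace ℝ (Fin d) → ℝ) (hg : Continuous g) {ε : ℝ}
    (hε : 0 < ε) : ∃ p : MvPolynomial (Fin d) ℝ, ∀ x ∈ Metric.closedBall 0 1,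
      |pev p x - g x| < ε := by
  let X : Fin d → C(EuclideanSpace ℝ (Fin d), ℝ) := fun i =>
    ⟨fun x => x i, (contDiff_coord i).continuous⟩
  let A : Subalgebra ℝ C(EuclideanSpace ℝ (Fin d), ℝ) := (MvPolynomial.aeval X).range
  have hA : A.SeparatesPoints := by
    intro x y hxy
    obtain ⟨i, hi⟩ : ∃ i, x i ≠ y i := by
      by_contra! h
      exact hxy (PiLp.ext h)
    exact ⟨X i, ⟨X i, ⟨MvPolynomial.X i, by simp⟩, rfl⟩, hi⟩
  obtain ⟨u, ⟨p, hp⟩, hu⟩ :=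
    ContinuousMap.exists_mem_subalgebra_near_continuous_of_isCompact_of_separatesPoints hA
      ⟨g, hg⟩ (isCompact_closedBall (0 : EuclideanSpace ℝ (Fin d)) 1) hε
  refine ⟨p, fun x hx => ?_⟩
  have e : pev p x = u x := by
    have h1 : ((ContinuousMap.evalAlgHom ℝ ℝ x).comp (MvPolynomial.aeval X)) p = u x := by
      rw [← hp]; rfl
    rw [← h1, MvPolynomial.comp_aeval]
    rfl
  rw [e]
  exact hu x hx

theorem topologicalClosure_range_toL2 (hd : 1 ≤ d) (hα : -1 < α) :
    (LinearMap.range (toL2 (d := d) hd hα)).topologicalClosure = ⊤ := by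
  have := isFiniteMeasure_weightMeasure hd hα
  rw [eq_top_iff]
  intro F _
  rw [← SetLike.mem_coe, Submodule.topologicalClosure_coe, Metric.mem_closure_iff]
  intro ε hε
  obtain ⟨g, -, hg, hgc, hgm⟩ := (Lp.memLp F).exists_hasCompactSupport_eLpNorm_sub_le
    (by norm_num) (ε := ENNReal.ofReal (ε / 3)) (by simpa using hε)
  set M := ((weightMeasure d α Set.univ) ^ (2 : ℝ)⁻¹).toReal with hM
  have hM' : (weightMeasure d α Set.univ) ^ (2 : ℝ)⁻¹ ≠ (⊤ : ℝ≥0∞) :=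
    ENNReal.rpow_ne_top_of_nonneg (by norm_num) (measure_ne_top _ _)
  have hM0 : 0 ≤ M := ENNReal.toReal_nonneg
  -- `M` is the square root of the total mass, so a uniform error `η` costs at most `M η` in norm;
  -- the `+ 1` keeps the denominator visibly positive.
  obtain ⟨p, hp⟩ := exists_pev_near g hgc (ε := ε / (3 * (M + 1))) (by positivity)
  refine ⟨toL2 hd hα p, ⟨p, rfl⟩, ?_⟩
  have h1 : dist F (hgm.toLp g) ≤ ε / 3 := by
    rw [Lp.dist_def]
    refine ENNReal.toReal_le_of_le_ofReal (by positivity) ?_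
    rwa [eLpNorm_congr_ae ((ae_eq_refl F).sub hgm.coeFn_toLp)]
  have h2 : dist (hgm.toLp g) (toL2 hd hα p) ≤ ε / 3 := by
    rw [Lp.dist_def]
    refine ENNReal.toReal_le_of_le_ofReal (by positivity) ?_
    have hpe : toL2 hd hα p =ᵐ[weightMeasure d α] pev p := (memLp_pev hd hα p).coeFn_toLp
    rw [eLpNorm_congr_ae (hgm.coeFn_toLp.sub hpe)]
    refine (eLpNorm_le_of_ae_bound (C := ε / (3 * (M + 1))) ?_).trans ?_
    · refine weightMeasure_absolutelyContinuous.ae_le ?_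
      filter_upwards [ae_restrict_mem Metric.isOpen_ball.measurableSet] with x hx
      rw [Pi.sub_apply, norm_sub_rev]
      exact (hp x (Metric.ball_subset_closedBall hx)).le
    · rw [ENNReal.toReal_ofNat, ← ENNReal.ofReal_toReal hM', ← hM,
        ← ENNReal.ofReal_mul hM0]
      refine ENNReal.ofReal_le_ofReal ?_
      rw [mul_div_assoc', div_le_div_iff₀ (by positivity) (by positivity)]
      nlinarith
  calc dist F (toL2 hd hα p) ≤ dist F (hgm.toLp g) + dist (hgm.toLp g) (toL2 hd hα p) :=
        dist_triangle _ _ _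
    _ < ε := by linarith

end Density

/-! ### The approximation estimate -/

section Main

variable {d : ℕ}

theorem Reg.laplace_iterate {k : ℕ} {α : ℝ} {f : EuclideanSpace ℝ (Fin d) → ℝ} (i : ℕ)
    (h : Reg d (2 * i + k) α f) : Reg d k (α + 2 * i) (BallApprox.laplace^[i] f) := by
  induction i generalizing α f with
  | zero => simpa using h
  | succ i ih =>
    rw [show 2 * (i + 1) + k = 2 * i + k + 2 by ring] at h
    have := ih (Reg.laplace h)
    rw [Function.iterate_succ_apply]
    push_cast
    rwa [show α + 2 * ((i : ℝ) + 1) = α + 2 + 2 * i by ring]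

/-- The approximant is the orthogonal projection of `f` onto polynomials of degree at most `n`.
Parseval for the error leaves the coefficients of degree above `n`, which are split according to
whether `c < δ m²`. -/
theorem exists_norm_sub_toL2_mul_le (hd : 1 ≤ d) {μ : ℝ} (hμ : -1 < μ) {s : ℕ} (hs : 1 ≤ s)
    {f : EuclideanSpace ℝ (Fin d) → ℝ} (hf : Reg d (2 * s) μ f)
    (hA : MemLp (laplace^[s] f) 2 (weightMeasure d (μ + 2 * s)))
    (hB : MemLp (laplaceBeltrami^[s] f) 2 (weightMeasure d μ)) {n : ℕ} (hn : 2 * s ≤ n) :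
    ∃ p ∈ MvPolynomial.restrictTotalDegree (Fin d) ℝ n,
      ‖hf.memLp.toLp f - toL2 hd hμ p‖ * (1 / (3 * (2 * s + 1) ^ 2) * (n : ℝ) ^ 2) ^ s ≤
        ‖hA.toLp (laplace^[s] f)‖ + ‖hB.toLp (laplaceBeltrami^[s] f)‖ := by
  classical
  obtain ⟨k, e, c, he, horth, hc, hspan⟩ := exists_orthPoly_basis hd hμ
  have hμs : -1 < μ + 2 * s := by
    have : (0 : ℝ) ≤ s := Nat.cast_nonneg s
    linarith
  set F := hf.memLp.toLp f with hF
  set A := hA.toLp (laplace^[s] f)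
  set B := hB.toLp (laplaceBeltrami^[s] f)
  set δ : ℝ := 1 / (3 * (2 * s + 1) ^ 2) with hδ
  have hδ0 : 0 < δ := by positivity
  let E := fun z => toL2 hd hμ (e z)
  let b : HilbertBasis (Σ m, Fin (k m)) ℝ (Lp ℝ 2 (weightMeasure d μ)) :=
    HilbertBasis.mk he (by
      rw [← topologicalClosure_range_toL2 hd hμ]
      refine Submodule.topologicalClosure_mono ?_
      rw [LinearMap.range_eq_map, ← hspan, Submodule.map_span, ← Set.range_comp]
      rfl)
  have hb : ∀ z, b z = E z := fun z => by rw [HilbertBasis.coe_mk]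
  let I : Finset (Σ m, Fin (k m)) := (Finset.range (n + 1)).sigma fun _ => Finset.univ
  let p := ∑ z ∈ I, (inner ℝ (E z) F : ℝ) • e z
  have hp : toL2 hd hμ p = ∑ z ∈ I, (inner ℝ (E z) F : ℝ) • E z := by
    simp only [p, map_sum, map_smul, E]
  refine ⟨p, ?_, ?_⟩
  · rw [← degLT_succ]
    refine Submodule.sum_mem _ fun z hz => Submodule.smul_mem _ _ ?_
    have : z.1 < n + 1 := by simpa [I] using hz
    exact degLT_mono (by omega) (horth z).mem
  have hcoef : ∀ z, inner ℝ (E z) (F - toL2 hd hμ p) =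
      if z.1 ≤ n then 0 else inner ℝ (E z) F := by
    intro z
    rw [inner_sub_right, hp]
    split_ifs with h
    · rw [he.inner_right_sum _ (by simpa [I, Nat.lt_succ_iff] using h), sub_self]
    · rw [inner_sum, Finset.sum_eq_zero, sub_zero]
      intro w hw
      have hzw : z ≠ w := by
        rintro rfl
        exact h (by simpa [I, Nat.lt_succ_iff] using hw)
      rw [inner_smul_right, he.2 hzw, mul_zero]
  have ha : ∀ z, inner ℝ (E z) F = ∫ x, f x * pev (e z) x ∂(weightMeasure d μ) :=
    fun z => inner_toL2_toLp hd hμ _ _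
  set K : ℝ := (δ * (n : ℝ) ^ 2) ^ (2 * s) with hK
  have hn0 : (0 : ℝ) < n := by exact_mod_cast (by omega : 0 < n)
  have hK0 : 0 < K := by positivity
  have hmn : ∀ m : ℕ, n < m → δ * (n : ℝ) ^ 2 ≤ δ * (m : ℝ) ^ 2 := fun m hm => by gcongr
  have bound1 : ∀ t : Finset (Σ m, Fin (k m)), (∀ z ∈ t, n < z.1 ∧ c z < δ * (z.1 : ℝ) ^ 2) →
      (∑ z ∈ t, inner ℝ (E z) F ^ 2) * K ≤ ‖A‖ ^ 2 := by
    intro t ht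
    let τ := fun z => lapPowFactor d s μ z.1 (c z)
    have hτK : ∀ z ∈ t, K ≤ τ z := fun z hz =>
      (pow_le_pow_left₀ (by positivity) (hmn _ (ht z hz).1) _).trans
        (pow_le_lapPowFactor hd hμ (by have := (ht z hz).1; omega) (ht z hz).2)
    -- The vectors `Δ^s e_z` are orthogonal with squared norms `τ z`: this is `integral_laplace_pow`
    -- along the iterated Laplacians of `e_z'`.
    have h1 := sum_inner_sq_div_le t (fun z => toL2 hd hμs (lapP^[s] (e z))) τ
      (fun z hz => hK0.trans_le (hτK z hz)) (fun z hz z' _ => by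
        rw [inner_toL2, integral_laplace_pow hd hμ s z.1 (by have := (ht z hz).1; omega) (horth z)
          (hc z) (fun i => pev (lapP^[i] (e z'))) (fun i _ => memLp_pev hd (by
            have : (0 : ℝ) ≤ i := Nat.cast_nonneg i
            linarith) _)
          (fun i _ φ hφ => by rw [integral_pev_mul_lapC _ hφ, Function.iterate_succ_apply'])]
        have := orthonormal_iff_ite.1 he z z'
        rw [inner_toL2] at this
        rw [Function.iterate_zero_apply, this]
        simp [τ]) A
    refine le_trans ?_ h1
    rw [Finset.sum_mul]
    refine Finset.sum_le_sum fun z hz => ?_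
    have h2 : inner ℝ (toL2 hd hμs (lapP^[s] (e z))) A = τ z * inner ℝ (E z) F := by
      rw [inner_toL2_toLp, ha]
      exact integral_laplace_pow hd hμ s z.1 (by have := (ht z hz).1; omega) (horth z)
        (hc z) (fun i => laplace^[i] f)
        (fun i hi => ((show Reg d (2 * i + 2 * (s - i)) μ f by
          rwa [show 2 * i + 2 * (s - i) = 2 * s by omega]).laplace_iterate i).memLp)
        (fun i hi φ hφ => by
          have h3 := ((show Reg d (2 * i + (2 * (s - i - 1) + 2)) μ f by
            rwa [show 2 * i + (2 * (s - i - 1) + 2) = 2 * s by omega]).laplace_iterate i)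
          simp only [Function.iterate_succ_apply']
          exact h3.integral_laplace hφ)
    have h4 : 0 < τ z := hK0.trans_le (hτK z hz)
    rw [h2, show (τ z * inner ℝ (E z) F) ^ 2 / τ z = inner ℝ (E z) F ^ 2 * τ z by field_simp]
    exact mul_le_mul_of_nonneg_left (hτK z hz) (sq_nonneg _)
  have bound2 : ∀ t : Finset (Σ m, Fin (k m)), (∀ z ∈ t, n < z.1 ∧ δ * (z.1 : ℝ) ^ 2 ≤ c z) →
      (∑ z ∈ t, inner ℝ (E z) F ^ 2) * K ≤ ‖B‖ ^ 2 := by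
    intro t ht
    have h1 := sum_inner_sq_div_le t E (fun _ => 1) (fun _ _ => one_pos)
      (fun z _ z' _ => orthonormal_iff_ite.1 he z z') B
    refine le_trans ?_ h1
    rw [Finset.sum_mul]
    refine Finset.sum_le_sum fun z hz => ?_
    have h2 : inner ℝ (E z) B = (-c z) ^ s * inner ℝ (E z) F := by
      rw [ha, inner_toL2_toLp, integral_mul_pev_eq_integral_mul_lbP hd hμ hf.memLp hB s
        (fun φ hφ => hf.integral_laplaceBeltrami_iterate hφ), lbP_iterate_of_eigenvector (hc z)]
      simp only [pev_smul, mul_left_comm _ ((-c z) ^ s)]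
      rw [integral_const_mul]
    have h3 : K ≤ ((-c z) ^ s) ^ 2 := by
      rw [← pow_mul, mul_comm s 2, Even.neg_pow (even_two_mul s)]
      exact pow_le_pow_left₀ (by positivity) ((hmn _ (ht z hz).1).trans (ht z hz).2) _
    rw [h2, div_one, mul_pow, mul_comm]
    exact mul_le_mul_of_nonneg_right h3 (sq_nonneg _)
  have hsum : ‖F - toL2 hd hμ p‖ ^ 2 ≤ (‖A‖ ^ 2 + ‖B‖ ^ 2) / K := by
    have hs1 := b.hasSum_inner_mul_inner (F - toL2 hd hμ p) (F - toL2 hd hμ p)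
    rw [real_inner_self_eq_norm_sq] at hs1
    refine hasSum_le_of_sum_le hs1 fun t => ?_
    rw [le_div_iff₀ hK0]
    have e1 : ∑ z ∈ t, inner ℝ (F - toL2 hd hμ p) (b z) * inner ℝ (b z) (F - toL2 hd hμ p) =
        ∑ z ∈ t with n < z.1, inner ℝ (E z) F ^ 2 := by
      rw [Finset.sum_filter]
      refine Finset.sum_congr rfl fun z _ => ?_
      rw [real_inner_comm, hb, hcoef]
      by_cases h : z.1 ≤ n
      · simp [h]
      · simp [h, not_le.1 h, pow_two]
    rw [e1, ← Finset.sum_filter_add_sum_filter_not _ (fun z => c z < δ * (z.1 : ℝ) ^ 2), add_mul]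
    refine add_le_add (bound1 _ fun z hz => ?_) (bound2 _ fun z hz => ?_)
    · simp only [Finset.mem_filter] at hz
      exact ⟨hz.1.2, hz.2⟩
    · simp only [Finset.mem_filter] at hz
      exact ⟨hz.1.2, not_lt.1 hz.2⟩
  rw [le_div_iff₀ hK0, hK, mul_comm 2 s, pow_mul, ← mul_pow] at hsum
  refine (pow_le_pow_iff_left₀ (by positivity) (by positivity) two_ne_zero).1 (hsum.trans ?_)
  -- Here `K` is the square of `(δ n²)^s`, and `‖A‖² + ‖B‖² ≤ (‖A‖ + ‖B‖)²`.
  nlinarith [norm_nonneg A, norm_nonneg B]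

end Main

end BallApprox

theorem mainTheorem3 (d : ℕ) (hd : 1 ≤ d) (μ : ℝ) (hμ : -1 < μ) (s : ℕ) (hs : 1 ≤ s) :
    ∃ c : ℝ, 0 < c ∧
      ∀ f : EuclideanSpace ℝ (Fin d) → ℝ, BallApprox.MemW (2 * s) μ f →
        ∀ n : ℕ, 2 * s ≤ n →
          BallApprox.bestApprox n μ f ≤
            ENNReal.ofReal (c / (n : ℝ) ^ (2 * s)) *
              (BallApprox.wnorm (μ + 2 * (s : ℝ)) (BallApprox.laplace^[s] f) +
                BallApprox.wnorm μ (BallApprox.laplaceBeltrami^[s] f)) := by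
  open BallApprox in
  have hs0 : (0 : ℝ) ≤ s := Nat.cast_nonneg s
  have hμs : -1 < μ + 2 * s := by linarith
  -- `κ` is the normalizing factor `√b_α`; it differs between the exponents `μ` and `μ + 2 * s`.
  have hκ : ∀ α : ℝ, -1 < α → ∃ κ : ℝ, 0 < κ ∧ ∀ f : EuclideanSpace ℝ (Fin d) → ℝ,
      wnorm α f = ENNReal.ofReal κ * eLpNorm f 2 (weightMeasure d α) := by
    intro α hα
    have := isFiniteMeasure_weightMeasure hd hα
    have h0 : (weightMeasure d α Set.univ)⁻¹ ≠ 0 := by simp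
    have h1 : (weightMeasure d α Set.univ)⁻¹ ≠ (⊤ : ℝ≥0∞) := by
      simpa using weightMeasure_univ_ne_zero
    have h2 : (weightMeasure d α Set.univ)⁻¹ ^ (2 : ℝ)⁻¹ ≠ (⊤ : ℝ≥0∞) :=
      ENNReal.rpow_ne_top_of_nonneg (by norm_num) h1
    have h3 : 0 < (weightMeasure d α Set.univ)⁻¹ ^ (2 : ℝ)⁻¹ :=
      ENNReal.rpow_pos (pos_iff_ne_zero.2 h0) h1
    exact ⟨_, ENNReal.toReal_pos h3.ne' h2, fun f => by
      rw [ENNReal.ofReal_toReal h2, wnorm_eq]⟩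
  obtain ⟨κ, hκ0, hκμ⟩ := hκ μ hμ
  obtain ⟨κ', hκ0', hκμ'⟩ := hκ _ hμs
  set δ : ℝ := 1 / (3 * (2 * s + 1) ^ 2) with hδ
  have hδ0 : 0 < δ := by positivity
  -- Converting normalizations costs `κ / κ'` for the Laplacian term and `1` for the
  -- Laplace–Beltrami term; the sum dominates both.
  refine ⟨(δ ^ s)⁻¹ * (κ / κ' + 1), by positivity, fun f hf n hn => ?_⟩
  have hn0 : (0 : ℝ) < n := by exact_mod_cast (by omega : 0 < n)
  have hR := hf.reg hd hμ
  have hA : MemLp (laplace^[s] f) 2 (weightMeasure d (μ + 2 * s)) :=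
    (Reg.laplace_iterate (k := 0) s hR).memLp
  by_cases hB : MemLp (laplaceBeltrami^[s] f) 2 (weightMeasure d μ)
  swap
  · have hm : AEStronglyMeasurable (laplaceBeltrami^[s] f) (weightMeasure d μ) :=
      (hR.laplaceBeltrami_iterate.aestronglyMeasurable).mono_ac
        weightMeasure_absolutelyContinuous
    have htop : eLpNorm (laplaceBeltrami^[s] f) 2 (weightMeasure d μ) = ⊤ := by
      by_contra h
      exact hB ⟨hm, lt_top_iff_ne_top.2 h⟩
    rw [hκμ (laplaceBeltrami^[s] f), htop, ENNReal.mul_top (by simpa using hκ0), add_top,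
      -- The prefactor must be nonzero here, since `0 * ∞ = 0` in `ℝ≥0∞`.
      ENNReal.mul_top (by simp only [ne_eq, ENNReal.ofReal_eq_zero, not_le]; positivity)]
    exact le_top
  obtain ⟨p, hp, hle⟩ := exists_norm_sub_toL2_mul_le hd hμ hs hR hA hB hn
  refine (iInf_le _ (⟨p, hp⟩ : MvPolynomial.restrictTotalDegree (Fin d) ℝ n)).trans ?_
  have hF := hR.memLp
  set F := hF.toLp f
  set A := hA.toLp (laplace^[s] f) with hA'
  set B := hB.toLp (laplaceBeltrami^[s] f) with hB'
  have e1 : wnorm μ (fun x => f x - MvPolynomial.eval (fun i => x i) p) =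
      ENNReal.ofReal (κ * ‖F - toL2 hd hμ p‖) := by
    have h : eLpNorm (F - toL2 hd hμ p : Lp ℝ 2 (weightMeasure d μ)) 2 (weightMeasure d μ) =
        eLpNorm (fun x => f x - pev p x) 2 (weightMeasure d μ) := by
      have hpe : toL2 hd hμ p =ᵐ[weightMeasure d μ] pev p := (memLp_pev hd hμ p).coeFn_toLp
      exact eLpNorm_congr_ae ((Lp.coeFn_sub _ _).trans (hF.coeFn_toLp.sub hpe))
    rw [hκμ, ENNReal.ofReal_mul hκ0.le, Lp.norm_def, h, ENNReal.ofReal_toReal]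
    · rfl
    · rw [← h]; exact Lp.eLpNorm_ne_top _
  have e2 : wnorm (μ + 2 * s) (laplace^[s] f) = ENNReal.ofReal (κ' * ‖A‖) := by
    rw [hκμ', ENNReal.ofReal_mul hκ0'.le, hA', Lp.norm_toLp, ENNReal.ofReal_toReal hA.2.ne]
  have e3 : wnorm μ (laplaceBeltrami^[s] f) = ENNReal.ofReal (κ * ‖B‖) := by
    rw [hκμ, ENNReal.ofReal_mul hκ0.le, hB', Lp.norm_toLp, ENNReal.ofReal_toReal hB.2.ne]
  rw [e1, e2, e3, ← ENNReal.ofReal_add (by positivity) (by positivity),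
    ← ENNReal.ofReal_mul (by positivity)]
  refine ENNReal.ofReal_le_ofReal ?_
  rw [mul_pow, ← pow_mul, ← le_div_iff₀ (by positivity)] at hle
  calc κ * ‖F - toL2 hd hμ p‖ ≤ κ * ((‖A‖ + ‖B‖) / (δ ^ s * (n : ℝ) ^ (2 * s))) :=
        mul_le_mul_of_nonneg_left hle hκ0.le
    _ = (δ ^ s)⁻¹ / (n : ℝ) ^ (2 * s) * (κ / κ' * (κ' * ‖A‖) + 1 * (κ * ‖B‖)) := by
        field_simp
    _ ≤ (δ ^ s)⁻¹ / (n : ℝ) ^ (2 * s) *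
          ((κ / κ' + 1) * (κ' * ‖A‖) + (κ / κ' + 1) * (κ * ‖B‖)) := by
        gcongr
        · linarith
        · have : 0 ≤ κ / κ' := by positivity
          linarith
    _ = _ := by ring
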